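/- A Blaschke product is a function on the open unit disc $\mathbb D$ of the form $$B(z)=c\,z^p\prod_{k}\frac{|a_k|}{a_k}\,\frac{a_k-z}{1-\overline{a_k}\,z},$$ with $|c|=1$, $p\in\{0,1,2,\dots\}$, a finite or infinite family of points $a_k\in\mathbb D\setminus\{0\}$, and $\sum_k(1-|a_k|)<\infty$. A point of the unit circle $\mathbb T$ is a singularity of $B$ if $B$ has no analytic extension to a neighbourhood of it, and a regular point otherwise; at regular points, $B$ also denotes the value of the extension. An invariant of $B$ is a continuous map $x:\mathbb T\to\mathbb T$ that maps singularities to singularities and regular points to regular points and satisfies $B(x(\zeta))=B(\zeta)$ at every regular point $\zeta$. Let $\mathcal G$ be the set of invariants, with composition. Let $B$ be a Blaschke product with exactly $m$ singularities $\lambda_1,\dots,\lambda_m$, where $1\le m<\infty$, and suppose that for each $j$ zeros of $B$ approach $\lambda_j$ inside a nontangential region: for some $\alpha_j>1$ there is a sequence of zeros of $B$ in the Stolz region $\{z\in\mathbb D: |\lambda_j-z|<\alpha_j(1-|z|)\}$ that converges to $\lambda_j$. (This holds in particular if all zeros of $B$ near $\lambda_j$ lie in such a region.) Then $\mathcal G$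 is a group, and $$\mathcal G\cong\mathbb Z^m\rtimes\mathbb Z_m ,$$ where $\mathbb Z_m$ acts on $\mathbb Z^m$ by cyclic permutation of the coordinates. More precisely, number the singularities counterclockwise, with indices modulo $m$, and let $I_j$ be the open arc of $\mathbb T$ that runs counterclockwise from $\lambda_j$ to $\lambda_{j+1}$ (the arc $\mathbb T\setminus\{\lambda_1\}$ if $m=1$). For every $j$ and every $\lambda\in\mathbb T$ the solutions of $B(\zeta)=\lambda$ on $I_j$ form a two-sided sequence $(z_{n,\lambda,j})_{n\in\mathbb Z}$ in order of increasing argument, and they can be indexed so that $z_{0,\lambda,j}$ lies on the arc from $z_{0,1,j}$ (included) to $z_{1,1,j}$ (excluded), and so that there are $x_1,\dots,x_m,y\in\mathcal G$ with the following properties, for all $n\in\mathbb Z$, $\lambda\in\mathbb T$ and all $j$: * $x_j(z_{n,\lambda,j})=z_{n+1,\lambda,j}$, and $x_j$ fixes every point of $I_k$ for $k\ne j$; * $y(z_{n,\lambda,j})=z_{n,\lambda,j+1}$; * $\mathcal G$ has the presentation $$\mathcal G=\langle x_1,\dots,x_m,y:\ y^m=e,\ y x_j=x_{j+1}y,\ x_jx_l=x_lx_j\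 \text{ for all } j,l\rangle ;$$ * an isomorphism $\mathcal G\cong\mathbb Z^m\rtimes\mathbb Z_m$ takes $x_j$ to the $j$-th standard basis vector of $\mathbb Z^m$ and $y$ to the generator $1$ of $\mathbb Z_m$. -/

import Mathlib

open Set Filter Topology
open scoped ComplexConjugate

noncomputable section

/-- `B` is, on the open unit disc, a (finite or infinite) Blaschke product
`c z ^ p ∏ (|a_j| / a_j) (a_j - z) / (1 - conj a_j z)` with `|c| = 1`, `0 < |a_j| < 1` and
`∑ (1 - |a_j|) < ∞`. Values of `B` off the disc play no role. -/
def IsBlaschkeProduct (B : ℂ → ℂ) : Prop :=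
  ∃ (c : ℂ) (p : ℕ) (ι : Type) (a : ι → ℂ), ‖c‖ = 1 ∧ (∀ j, 0 < ‖a j‖ ∧ ‖a j‖ < 1) ∧
    Summable (fun j => 1 - ‖a j‖) ∧
    ∀ z ∈ Metric.ball (0 : ℂ) 1,
      B z = c * z ^ p * ∏' j, ((‖a j‖ : ℂ) / a j) * ((a j - z) / (1 - conj (a j) * z))

/-- The singularities (the spectrum) of `B`: the points of the unit circle near which `B`, as a
function on the open unit disc, has no analytic extension. -/
def singularities (B : ℂ → ℂ) : Set Circle :=
  {w | ¬ ∃ g : ℂ → ℂ, AnalyticAt ℂ g w ∧ ∀ᶠ z in 𝓝[Metric.ball (0 : ℂ) 1] (w : ℂ), g z = B z}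

/-- The boundary function of `B` at a point of the circle: the limit of `B` from inside the disc.
It is used only at points that are not singularities, where this limit exists and is the value of
the analytic extension. -/
def boundaryValue (B : ℂ → ℂ) (w : Circle) : ℂ :=
  extendFrom (Metric.ball (0 : ℂ) 1) B w

/-- The zeros of `B` in the open unit disc. -/
def discZeros (B : ℂ → ℂ) : Set ℂ :=
  {z | z ∈ Metric.ball (0 : ℂ) 1 ∧ B z = 0}

/-- The nontangential (Stolz) region at the point `w` of the circle with aperture `α`. -/
def stolzRegion (α : ℝ) (w : Circle) : Set ℂ :=
  {z | z ∈ Metric.ball (0 : ℂ) 1 ∧ ‖(w : ℂ) - z‖ < α * (1 - ‖z‖)}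

/-- The invariants of `B`: the continuous maps `x` of the circle to itself that map singular points
to singular points and regular points to regular points and satisfy `B ∘ x = B` at the regular
points, with composition as multiplication. That all of them are invertible is not built in. -/
def invariants (B : ℂ → ℂ) : Submonoid (Function.End Circle) where
  carrier := {x | Continuous (x : Circle → Circle) ∧
    (∀ w, x w ∈ singularities B ↔ w ∈ singularities B) ∧
    ∀ w, w ∉ singularities B → boundaryValue B (x w) = boundaryValue B w}
  one_mem' := ⟨continuous_id, fun _ => Iff.rfl, fun _ _ => rfl⟩
  mul_mem' := by
    rintro x y ⟨hx, hxs, hxB⟩ ⟨hy, hys, hyB⟩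
    refine ⟨hx.comp hy, fun w => (hxs (y w)).trans (hys w), fun w hw => ?_⟩
    exact (hxB (y w) fun h => hw ((hys w).1 h)).trans (hyB w hw)

/-- `t` lists arguments of the `m` points of `S` in counterclockwise order, the list being continued
to all integer indices by `t (j + m) = t j + 2 π`. The complement of `S` in the circle consists of
the open arcs `I_j = {exp (i s) : t j < s < t (j + 1)}`, where `I_(j + m) = I_j`. -/
structure IsCyclicEnumeration (S : Set Circle) (m : ℕ) (t : ℤ → ℝ) : Prop where
  strictMono : StrictMono t
  add_period : ∀ j, t (j + m) = t j + 2 * Real.pi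
  range_eq : range (fun j => Circle.exp (t j)) = S

/-- `z j n w`, for integers `n`, are the arguments of the solutions of `B = w` on the arc `I_j`, in
increasing order; the solutions with index `0` lie between those with indices `0` and `1`
for `w = 1`. -/
structure IsLabelling (B : ℂ → ℂ) (m : ℕ) (t : ℤ → ℝ) (z : ℤ → ℤ → Circle → ℝ) : Prop where
  strictMono : ∀ j w, StrictMono (fun n => z j n w)
  range_eq : ∀ j (w : Circle), range (fun n => z j n w) =
    {s | s ∈ Ioo (t j) (t (j + 1)) ∧ boundaryValue B (Circle.exp s) = w}
  base : ∀ j w, z j 0 w ∈ Ico (z j 0 1) (z j 1 1)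
  add_period : ∀ j n w, z (j + m) n w = z j n w + 2 * Real.pi

/-- The relations `y ^ m = 1`, `y x_j = x_(j+1) y` and `x_j x_l = x_l x_j` (indices modulo `m`)
between the generators `x_j = Sum.inl j` and `y = Sum.inr ()`. -/
def shiftRotationRels (m : ℕ) : Set (FreeGroup (ZMod m ⊕ Unit)) :=
  let x : ZMod m → FreeGroup (ZMod m ⊕ Unit) := fun j => FreeGroup.of (Sum.inl j)
  let y : FreeGroup (ZMod m ⊕ Unit) := FreeGroup.of (Sum.inr ())
  {y ^ m} ∪ range (fun j => (y * x j) * (x (j + 1) * y)⁻¹) ∪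
    range (fun q : ZMod m × ZMod m => (x q.1 * x q.2) * (x q.2 * x q.1)⁻¹)

/-- The semidirect product of `ℤ ^ m` and the cyclic group `ℤ_m`, which acts by cyclic permutation
of the coordinates: `r` takes `f` to `a ↦ f (a - r)`. -/
abbrev ShiftRotationGroup (m : ℕ) : Type :=
  SemidirectProduct (ZMod m → Multiplicative ℤ) (Multiplicative (ZMod m))
    (mulAutArrow (G := Multiplicative (ZMod m)) (A := ZMod m) (M := Multiplicative ℤ))

end

/-! At a regular point of the circle `B` has modulus 1, and the derivative of its argument along the
circle is `p` plus the sum of the Poisson kernels with poles at the zeros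
(`mul_logDeriv_blaschkeProd`). So the argument increases strictly along each arc I_j between
consecutive singularities. A zero `a` in a Stolz region at an end point of I_j adds to this
increase, over a window inside I_j of length comparable to 1 - |a|, at least a constant that depends
only on the aperture (`le_integral_diskPoisson_of_stolz`). Infinitely many such zeros make the
argument unbounded at both ends. Hence the argument is a coordinate on I_j that runs through all of
ℝ (`exists_arc_parametrization`), and in this coordinate `B` is u ↦ exp(iu).

The group is read off from these coordinates. The circle becomes `ZMod m × WithBot ℝ`, where `⊥`
marks the singularity at which an arc starts. By continuity an invariant maps each open arc into one
open arc; since it preserves exp(iu), it acts there as a translation by an integer multiple of 2π.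
Comparing limits at the two ends of the arcs shows that consecutive arcs go to consecutive arcs, so
the arcs are rotated (`exists_circleAction_eq`). Conversely, a rotation of the arcs combined with
independent translations lifts to an order isomorphism of ℝ, which is continuous even at the
singularities. So the invariants are the image of an injective homomorphism from ℤ^m ⋊ ℤ_m; in
particular they are invertible. The presentation is then pure algebra: the relations suffice to
define a homomorphism from the semidirect product back to the presented group. -/

/-! ### Convergence of Blaschke products and their logarithmic derivative. -/

/-- The Blaschke factor with zero `a`, normalised to be positive at the origin. -/
noncomputable def blaschkeFactor (a z : ℂ) : ℂ :=
  ((‖a‖ : ℂ) / a) * ((a - z) / (1 - conj a * z))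

/-- The Poisson kernel of the disc with pole `a`. -/
noncomputable def diskPoisson (a z : ℂ) : ℝ := (1 - ‖a‖ ^ 2) / ‖z - a‖ ^ 2

/-- The points that keep a positive distance from the poles of the Blaschke factors. -/
def factorDomain {ι : Type} (a : ι → ℂ) : Set ℂ :=
  {z | ∃ r : ℝ, 0 < r ∧ ∀ k, r ≤ ‖1 - conj (a k) * z‖}

/-- The Blaschke product with zeros `a`, as a function on the plane. -/
noncomputable def blaschkeProd {ι : Type} (c : ℂ) (p : ℕ) (a : ι → ℂ) (z : ℂ) : ℂ :=
  c * z ^ p * ∏' k, blaschkeFactor (a k) z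

lemma norm_one_sub_conj_mul_of_norm_one (a : ℂ) {z : ℂ} (hz : ‖z‖ = 1) :
    ‖1 - conj a * z‖ = ‖z - a‖ := by
  have h : conj z * z = 1 := by
    rw [mul_comm, Complex.mul_conj, Complex.normSq_eq_norm_sq, hz]; simp
  have : 1 - conj a * z = conj (z - a) * z := by
    rw [map_sub, sub_mul, h]
  rw [this, norm_mul, hz, mul_one, Complex.norm_conj]

lemma isOpen_factorDomain {ι : Type} {a : ι → ℂ} (ha : ∀ k, ‖a k‖ < 1) :
    IsOpen (factorDomain a) := by
  rw [Metric.isOpen_iff]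
  rintro z ⟨r, hr, h⟩
  refine ⟨r / 2, by positivity, fun w hw => ⟨r / 2, by positivity, fun k => ?_⟩⟩
  have h1 : ‖conj (a k) * (w - z)‖ ≤ r / 2 := by
    rw [norm_mul, Complex.norm_conj]
    have := (mem_ball_iff_norm.1 hw).le
    nlinarith [ha k, norm_nonneg (a k), norm_nonneg (w - z)]
  have h2 : 1 - conj (a k) * z = (1 - conj (a k) * w) + conj (a k) * (w - z) := by ring
  have h3 := norm_add_le (1 - conj (a k) * w) (conj (a k) * (w - z))
  rw [← h2] at h3
  linarith [h k]

lemma ball_subset_factorDomain {ι : Type} {a : ι → ℂ} (ha : ∀ k, ‖a k‖ < 1) :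
    Metric.ball (0 : ℂ) 1 ⊆ factorDomain a := by
  intro z hz
  rw [mem_ball_zero_iff] at hz
  refine ⟨1 - ‖z‖, by linarith, fun k => ?_⟩
  have h := norm_sub_norm_le (1 : ℂ) (conj (a k) * z)
  rw [norm_mul, Complex.norm_conj, norm_one] at h
  nlinarith [ha k, norm_nonneg z]

/-- The numerator of the difference from 1 contains the factor 1 - |a|, so the Blaschke condition
gives absolute convergence wherever the denominators stay away from 0, including at regular points
of the circle. -/
lemma norm_blaschkeFactor_sub_one_le {a z : ℂ} (ha : 0 < ‖a‖) (ha1 : ‖a‖ < 1)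
    (hz : 1 - conj a * z ≠ 0) :
    ‖blaschkeFactor a z - 1‖ ≤ (1 - ‖a‖) * ((1 + ‖z‖) / ‖1 - conj a * z‖) := by
  have ha0 : a ≠ 0 := norm_pos_iff.1 ha
  have hn : conj a * a = (‖a‖ : ℂ) ^ 2 := Complex.conj_mul' a
  have h : blaschkeFactor a z - 1
      = -((1 - ‖a‖ : ℝ) : ℂ) * ((a + ‖a‖ * z) / a) / (1 - conj a * z) := by
    unfold blaschkeFactor
    push_cast
    generalize conj a = b at hz hn
    have hz' : 1 - z * b ≠ 0 := by rwa [mul_comm]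
    field_simp
    linear_combination (z : ℂ) * hn
  rw [h, norm_div, norm_mul, norm_neg, Complex.norm_real, norm_div, Real.norm_of_nonneg (by linarith),
    mul_div_assoc]
  have h2 : ‖a + ‖a‖ * z‖ / ‖a‖ ≤ 1 + ‖z‖ := by
    rw [div_le_iff₀ ha]
    refine (norm_add_le _ _).trans ?_
    rw [norm_mul, Complex.norm_real, norm_norm]
    linarith
  have := norm_nonneg (1 - conj a * z)
  gcongr

/-- Halving the lower bound for the denominators at `z₀` leaves a uniform bound on a ball, and the
Weierstrass test applies there. The ball may cross the circle, so the product itself is the analytic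
extension of `B`. -/
lemma exists_ball_multipliable_blaschkeFactor {ι : Type} {a : ι → ℂ}
    (ha : ∀ k, 0 < ‖a k‖ ∧ ‖a k‖ < 1) (hs : Summable fun k => 1 - ‖a k‖) {z₀ : ℂ}
    (hz₀ : z₀ ∈ factorDomain a) :
    ∃ ρ > 0, (∀ z ∈ Metric.ball z₀ ρ, ∀ k, 1 - conj (a k) * z ≠ 0) ∧
      (∀ k, DifferentiableOn ℂ (blaschkeFactor (a k)) (Metric.ball z₀ ρ)) ∧
      MultipliableLocallyUniformlyOn (fun k z => blaschkeFactor (a k) z) (Metric.ball z₀ ρ) := by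
  obtain ⟨r, hr, h⟩ := hz₀
  have key : ∀ z ∈ Metric.ball z₀ (r / 2), ∀ k, r / 2 ≤ ‖1 - conj (a k) * z‖ := by
    intro w hw k
    have h1 : ‖conj (a k) * (w - z₀)‖ ≤ r / 2 := by
      rw [norm_mul, Complex.norm_conj]
      have := (mem_ball_iff_norm.1 hw).le
      nlinarith [(ha k).2, norm_nonneg (a k), norm_nonneg (w - z₀)]
    have h2 : 1 - conj (a k) * z₀ = (1 - conj (a k) * w) + conj (a k) * (w - z₀) := by ring
    have h3 := norm_add_le (1 - conj (a k) * w) (conj (a k) * (w - z₀))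
    rw [← h2] at h3
    linarith [h k]
  have hne : ∀ z ∈ Metric.ball z₀ (r / 2), ∀ k, 1 - conj (a k) * z ≠ 0 := fun z hz k h0 => by
    have := key z hz k
    rw [h0, norm_zero] at this
    linarith
  have hd : ∀ k, DifferentiableOn ℂ (blaschkeFactor (a k)) (Metric.ball z₀ (r / 2)) := by
    intro k z hz
    have := hne z hz k
    have h : DifferentiableAt ℂ (fun z => (a k - z) / (1 - conj (a k) * z)) z :=
      DifferentiableAt.div (by fun_prop) (by fun_prop) this
    exact (h.const_mul _).differentiableWithinAt
  refine ⟨r / 2, by positivity, hne, hd, ?_⟩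
  have hsum : Summable fun k => (1 - ‖a k‖) * ((1 + (‖z₀‖ + r / 2)) / (r / 2)) := hs.mul_right _
  have := Summable.multipliableLocallyUniformlyOn_one_add (K := Metric.ball z₀ (r / 2))
    (f := fun k z => blaschkeFactor (a k) z - 1) Metric.isOpen_ball hsum
    (Eventually.of_forall fun k z hz => ?_) (fun k => (hd k).continuousOn.sub continuousOn_const)
  · simpa using this
  · refine (norm_blaschkeFactor_sub_one_le (ha k).1 (ha k).2 (hne z hz k)).trans ?_
    have h1 : ‖z‖ ≤ ‖z₀‖ + r / 2 := by
      have := norm_add_le z₀ (z - z₀)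
      rw [add_sub_cancel] at this
      linarith [mem_ball_iff_norm.1 hz]
    have h2 := key z hz k
    have h3 := (ha k).2
    gcongr

lemma differentiableAt_tprod_blaschkeFactor {ι : Type} {a : ι → ℂ}
    (ha : ∀ k, 0 < ‖a k‖ ∧ ‖a k‖ < 1) (hs : Summable fun k => 1 - ‖a k‖) {z : ℂ}
    (hz : z ∈ factorDomain a) :
    DifferentiableAt ℂ (fun z => ∏' k, blaschkeFactor (a k) z) z := by
  obtain ⟨ρ, hρ, -, hd, hm⟩ := exists_ball_multipliable_blaschkeFactor ha hs hz
  have := hm.hasProdLocallyUniformlyOn.differentiableOn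
    (.of_forall fun s => by
      simpa [Finset.prod_fn] using DifferentiableOn.finsetProd (fun k _ => hd k))
    Metric.isOpen_ball
  exact this.differentiableAt (Metric.ball_mem_nhds z hρ)

lemma differentiableAt_blaschkeProd {ι : Type} {a : ι → ℂ} (c : ℂ) (p : ℕ)
    (ha : ∀ k, 0 < ‖a k‖ ∧ ‖a k‖ < 1) (hs : Summable fun k => 1 - ‖a k‖) {z : ℂ}
    (hz : z ∈ factorDomain a) :
    DifferentiableAt ℂ (blaschkeProd c p a) z :=
  DifferentiableAt.mul (by fun_prop) (differentiableAt_tprod_blaschkeFactor ha hs hz)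

lemma analyticAt_blaschkeProd {ι : Type} {a : ι → ℂ} (c : ℂ) (p : ℕ)
    (ha : ∀ k, 0 < ‖a k‖ ∧ ‖a k‖ < 1) (hs : Summable fun k => 1 - ‖a k‖) {z : ℂ}
    (hz : z ∈ factorDomain a) : AnalyticAt ℂ (blaschkeProd c p a) z := by
  have : DifferentiableOn ℂ (blaschkeProd c p a) (factorDomain a) := fun w hw =>
    (differentiableAt_blaschkeProd c p ha hs hw).differentiableWithinAt
  exact this.analyticAt ((isOpen_factorDomain fun k => (ha k).2).mem_nhds hz)

lemma tprod_blaschkeFactor_ne_zero {ι : Type} {a : ι → ℂ}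
    (ha : ∀ k, 0 < ‖a k‖ ∧ ‖a k‖ < 1) (hs : Summable fun k => 1 - ‖a k‖) {z : ℂ}
    (hz : z ∈ factorDomain a) (hza : ∀ k, z ≠ a k) : ∏' k, blaschkeFactor (a k) z ≠ 0 := by
  obtain ⟨r, hr, h⟩ := hz
  have hne : ∀ k, 1 - conj (a k) * z ≠ 0 := fun k h0 => by
    have := h k
    rw [h0, norm_zero] at this
    linarith
  have h1 : Summable fun k => ‖blaschkeFactor (a k) z - 1‖ := by
    refine Summable.of_nonneg_of_le (fun k => norm_nonneg _) (fun k => ?_)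
      (hs.mul_right ((1 + ‖z‖) / r))
    refine (norm_blaschkeFactor_sub_one_le (ha k).1 (ha k).2 (hne k)).trans ?_
    have h3 := (ha k).2
    have h4 := h k
    gcongr
  have := tprod_one_add_ne_zero_of_summable (f := fun k => blaschkeFactor (a k) z - 1)
    (fun k => ?_) h1
  · simpa using this
  · have h5 : a k ≠ 0 := norm_pos_iff.1 (ha k).1
    have h6 : a k - z ≠ 0 := sub_ne_zero.2 (hza k).symm
    have h7 : (‖a k‖ : ℂ) ≠ 0 := by exact_mod_cast (ha k).1.ne'
    rw [add_sub_cancel]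
    exact mul_ne_zero (div_ne_zero h7 h5) (div_ne_zero h6 (hne k))

lemma norm_blaschkeFactor_of_norm_one {a z : ℂ} (ha : 0 < ‖a‖) (ha1 : ‖a‖ < 1) (hz : ‖z‖ = 1) :
    ‖blaschkeFactor a z‖ = 1 := by
  have h : 0 < ‖z - a‖ := by
    refine norm_pos_iff.2 (sub_ne_zero.2 ?_)
    rintro rfl
    linarith
  rw [blaschkeFactor, norm_mul, norm_div, norm_div, norm_one_sub_conj_mul_of_norm_one a hz,
    Complex.norm_real, norm_norm, norm_sub_rev, div_self ha.ne', div_self h.ne', one_mul]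

lemma norm_blaschkeProd_of_norm_one {ι : Type} {a : ι → ℂ} {c : ℂ} (hc : ‖c‖ = 1) (p : ℕ)
    (ha : ∀ k, 0 < ‖a k‖ ∧ ‖a k‖ < 1) (hs : Summable fun k => 1 - ‖a k‖) {z : ℂ}
    (hz : z ∈ factorDomain a) (hz1 : ‖z‖ = 1) : ‖blaschkeProd c p a z‖ = 1 := by
  obtain ⟨ρ, hρ, -, hd, hm⟩ := exists_ball_multipliable_blaschkeFactor ha hs hz
  have h := hm.multipliable (Metric.mem_ball_self hρ)
  have h1 : ∀ k, ‖blaschkeFactor (a k) z‖ = 1 := fun k =>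
    norm_blaschkeFactor_of_norm_one (ha k).1 (ha k).2 hz1
  rw [blaschkeProd, norm_mul, norm_mul, norm_pow, hc, hz1, h.norm_tprod]
  simp [h1]

/-- Along z = exp(is) the derivative of log b is i z b'/b; so this identity says that the argument
of a Blaschke factor increases at the rate given by the Poisson kernel. -/
lemma mul_logDeriv_blaschkeFactor {a z : ℂ} (ha : 0 < ‖a‖) (ha1 : ‖a‖ < 1) (hz : ‖z‖ = 1) :
    z * logDeriv (blaschkeFactor a) z = diskPoisson a z := by
  have h0 : z - a ≠ 0 := by
    refine sub_ne_zero.2 ?_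
    rintro rfl
    linarith
  have h0' : a - z ≠ 0 := by rwa [← neg_sub, neg_ne_zero]
  have h1 : 1 - conj a * z ≠ 0 := by
    rw [← norm_pos_iff, norm_one_sub_conj_mul_of_norm_one a hz]
    exact norm_pos_iff.2 h0
  have ha0 : a ≠ 0 := norm_pos_iff.1 ha
  have h7 : (‖a‖ : ℂ) ≠ 0 := by exact_mod_cast ha.ne'
  have hd : HasDerivAt (blaschkeFactor a) (((‖a‖ : ℂ) / a) *
      (((-1) * (1 - conj a * z) - (a - z) * (-(conj a * 1))) / (1 - conj a * z) ^ 2)) z := by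
    unfold blaschkeFactor
    exact ((((hasDerivAt_id z).const_sub a)).div
      (((hasDerivAt_id z).const_mul (conj a)).const_sub 1) h1).const_mul _
  have hzc : conj z * z = 1 := by
    rw [mul_comm, Complex.mul_conj, Complex.normSq_eq_norm_sq, hz]; simp
  have hn : conj a * a = (‖a‖ : ℂ) ^ 2 := Complex.conj_mul' a
  have hm : conj (z - a) * (z - a) = (‖z - a‖ : ℂ) ^ 2 := Complex.conj_mul' _
  have hfac : 1 - conj a * z = conj (z - a) * z := by
    rw [map_sub, sub_mul, hzc]
  have hz0 : z ≠ 0 := by rintro rfl; simp at hz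
  have h8 : conj (z - a) ≠ 0 := (map_ne_zero _).2 h0
  rw [logDeriv_apply, hd.deriv, blaschkeFactor, diskPoisson]
  push_cast
  rw [← hm, ← hn]
  have : a - z = -(z - a) := by ring
  rw [hfac, this]
  field_simp
  linear_combination -hfac

lemma diskPoisson_pos {a z : ℂ} (ha1 : ‖a‖ < 1) (hz : ‖z‖ = 1) : 0 < diskPoisson a z := by
  have h0 : 0 < ‖z - a‖ := by
    refine norm_pos_iff.2 (sub_ne_zero.2 ?_)
    rintro rfl
    linarith
  unfold diskPoisson
  have := norm_nonneg a
  have : 0 < 1 - ‖a‖ ^ 2 := by nlinarith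
  positivity

lemma summable_diskPoisson {ι : Type} {a : ι → ℂ}
    (ha : ∀ k, 0 < ‖a k‖ ∧ ‖a k‖ < 1) (hs : Summable fun k => 1 - ‖a k‖) {z : ℂ}
    (hz : z ∈ factorDomain a) (hz1 : ‖z‖ = 1) : Summable fun k => diskPoisson (a k) z := by
  obtain ⟨r, hr, h⟩ := hz
  refine Summable.of_nonneg_of_le (fun k => (diskPoisson_pos (ha k).2 hz1).le) (fun k => ?_)
      (hs.mul_right (2 / r ^ 2))
  have h1 := h k
  rw [norm_one_sub_conj_mul_of_norm_one _ hz1] at h1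
  have h2 := ha k
  unfold diskPoisson
  rw [mul_div_assoc']
  gcongr
  · nlinarith
  · nlinarith

lemma mul_logDeriv_blaschkeProd {ι : Type} {a : ι → ℂ} {c : ℂ} (hc : ‖c‖ = 1) (p : ℕ)
    (ha : ∀ k, 0 < ‖a k‖ ∧ ‖a k‖ < 1) (hs : Summable fun k => 1 - ‖a k‖) {z : ℂ}
    (hz : z ∈ factorDomain a) (hz1 : ‖z‖ = 1) :
    z * logDeriv (blaschkeProd c p a) z = ((p + ∑' k, diskPoisson (a k) z : ℝ) : ℂ) := by
  obtain ⟨ρ, hρ, -, hd, hm⟩ := exists_ball_multipliable_blaschkeFactor ha hs hz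
  have hz0 : z ≠ 0 := by rintro rfl; simp at hz1
  have hc0 : c ≠ 0 := by rintro rfl; simp at hc
  have hza : ∀ k, z ≠ a k := fun k h => by
    have := (ha k).2
    rw [← h] at this
    linarith
  have hsum := summable_diskPoisson ha hs hz hz1
  have hk : ∀ k, logDeriv (blaschkeFactor (a k)) z = (diskPoisson (a k) z : ℂ) * z⁻¹ := fun k => by
    rw [← mul_logDeriv_blaschkeFactor (ha k).1 (ha k).2 hz1]
    field_simp
  have hne := tprod_blaschkeFactor_ne_zero ha hs hz hza
  have hl := logDeriv_tprod_eq_tsum (f := fun k z => blaschkeFactor (a k) z) Metric.isOpen_ball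
    (Metric.mem_ball_self hρ)
    (fun k => by
      rw [← norm_pos_iff, norm_blaschkeFactor_of_norm_one (ha k).1 (ha k).2 hz1]; exact one_pos)
    hd (by
      have := (Complex.summable_ofReal.2 hsum).mul_right z⁻¹
      exact this.congr fun k => (hk k).symm) hm hne
  have h1 : logDeriv (blaschkeProd c p a) z = p / z + ∑' k, logDeriv (blaschkeFactor (a k)) z := by
    unfold blaschkeProd
    rw [logDeriv_mul (f := fun z => c * z ^ p) z (mul_ne_zero hc0 (pow_ne_zero _ hz0)) hne
      (by fun_prop) (differentiableAt_tprod_blaschkeFactor ha hs hz), hl,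
      logDeriv_const_mul z c hc0, logDeriv_fun_pow (by fun_prop)]
    simp [logDeriv_apply, div_eq_mul_inv]
  rw [h1]
  simp_rw [hk]
  rw [tsum_mul_right, Complex.ofReal_add, Complex.ofReal_tsum]
  push_cast
  field_simp

lemma blaschkeProd_zero {ι : Type} (a : ι → ℂ) (c : ℂ) (p : ℕ) (k : ι) :
    blaschkeProd c p a (a k) = 0 := by
  rw [blaschkeProd, tprod_of_exists_eq_zero ⟨k, by simp [blaschkeFactor]⟩, mul_zero]

lemma exists_eq_of_blaschkeProd_eq_zero {ι : Type} {a : ι → ℂ} {c : ℂ} (hc : ‖c‖ = 1) (p : ℕ)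
    (ha : ∀ k, 0 < ‖a k‖ ∧ ‖a k‖ < 1) (hs : Summable fun k => 1 - ‖a k‖) {z : ℂ}
    (hz : z ∈ factorDomain a) (hz0 : z ≠ 0) (h : blaschkeProd c p a z = 0) : ∃ k, z = a k := by
  by_contra! hza
  have hc0 : c ≠ 0 := by rintro rfl; simp at hc
  exact mul_ne_zero (mul_ne_zero hc0 (pow_ne_zero _ hz0))
    (tprod_blaschkeFactor_ne_zero ha hs hz hza) h

lemma exists_blaschkeProd_ne_zero {ι : Type} {a : ι → ℂ} {c : ℂ} (hc : ‖c‖ = 1) (p : ℕ)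
    (ha : ∀ k, 0 < ‖a k‖ ∧ ‖a k‖ < 1) (hs : Summable fun k => 1 - ‖a k‖) :
    ∃ z ∈ Metric.ball (0 : ℂ) 1, blaschkeProd c p a z ≠ 0 := by
  by_contra! h
  have hc0 : c ≠ 0 := by rintro rfl; simp at hc
  have h0 : (0 : ℂ) ∈ Metric.ball (0 : ℂ) 1 := Metric.mem_ball_self one_pos
  have h0' := ball_subset_factorDomain (fun k => (ha k).2) h0
  refine tprod_blaschkeFactor_ne_zero ha hs h0' (fun k hk => ?_) ?_
  · have := (ha k).1
    rw [← hk, norm_zero] at this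
    exact lt_irrefl _ this
  -- The factor `z ^ p` may vanish at 0, so the infinite product at 0 is obtained as a limit from
  -- points z ≠ 0.
  have h1 : Tendsto (fun z => ∏' k, blaschkeFactor (a k) z) (𝓝[≠] 0)
      (𝓝 (∏' k, blaschkeFactor (a k) 0)) :=
    (differentiableAt_tprod_blaschkeFactor ha hs h0').continuousAt.continuousWithinAt
  refine tendsto_nhds_unique (h1.congr' ?_) tendsto_const_nhds
  filter_upwards [self_mem_nhdsWithin, mem_nhdsWithin_of_mem_nhds (Metric.isOpen_ball.mem_nhds h0)]
    with z hz hzb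
  have := h z hzb
  rw [blaschkeProd, mul_eq_zero, mul_eq_zero] at this
  rcases this with (h2 | h2) | h2
  · exact absurd h2 hc0
  · exact absurd (eq_zero_of_pow_eq_zero h2) hz
  · exact h2

/-! ### Singularities are the accumulation points of zeros on the circle. -/

lemma Circle.coe_mem_closure_ball (w : Circle) : (w : ℂ) ∈ closure (Metric.ball (0 : ℂ) 1) := by
  rw [closure_ball _ one_ne_zero, mem_closedBall_zero_iff, Circle.norm_coe]

lemma eventually_eq_blaschkeProd {ι : Type} {a : ι → ℂ} {c : ℂ} {p : ℕ} {B : ℂ → ℂ}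
    (hB : ∀ z ∈ Metric.ball (0 : ℂ) 1, B z = blaschkeProd c p a z) (w : ℂ) :
    ∀ᶠ z in 𝓝[Metric.ball (0 : ℂ) 1] w, blaschkeProd c p a z = B z := by
  filter_upwards [self_mem_nhdsWithin] with z hz using (hB z hz).symm

/-- On the circle |1 - conj(a) z| = |z - a|, so `factorDomain` means positive distance from the
zeros. If zeros accumulate at `w`, an analytic extension has a non-isolated zero there, hence
vanishes near `w`, and by the identity theorem the product would vanish on the whole disc. -/
lemma notMem_singularities_iff {ι : Type} {a : ι → ℂ} {c : ℂ} (hc : ‖c‖ = 1) {p : ℕ}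
    (ha : ∀ k, 0 < ‖a k‖ ∧ ‖a k‖ < 1) (hs : Summable fun k => 1 - ‖a k‖) {B : ℂ → ℂ}
    (hB : ∀ z ∈ Metric.ball (0 : ℂ) 1, B z = blaschkeProd c p a z) (w : Circle) :
    w ∉ singularities B ↔ (w : ℂ) ∈ factorDomain a := by
  refine ⟨fun hw => ?_, fun hw => ?_⟩
  · obtain ⟨g, hg, hgB⟩ := not_not.1 hw
    by_contra hcon
    have hex : ∀ r > 0, ∃ k, ‖(w : ℂ) - a k‖ < r := by
      intro r hr
      by_contra! h
      exact hcon ⟨r, hr, fun k => by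
        rw [norm_one_sub_conj_mul_of_norm_one _ (Circle.norm_coe w)]; exact h k⟩
    have hfreq : ∃ᶠ z in 𝓝[Metric.ball (0 : ℂ) 1] (w : ℂ), B z = 0 := by
      intro hev
      obtain ⟨ε, hε, h⟩ := Metric.mem_nhdsWithin_iff.1 hev
      obtain ⟨k, hk⟩ := hex ε hε
      have hkb : a k ∈ Metric.ball (0 : ℂ) 1 := by simpa using (ha k).2
      refine h ⟨?_, hkb⟩ ?_
      · rwa [mem_ball_iff_norm, norm_sub_rev]
      · exact (hB _ hkb).trans (blaschkeProd_zero a c p k)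
    have hle : 𝓝[Metric.ball (0 : ℂ) 1] (w : ℂ) ≤ 𝓝[≠] (w : ℂ) :=
      nhdsWithin_mono _ fun z hz h => by
        rw [mem_singleton_iff.1 h, mem_ball_zero_iff, Circle.norm_coe] at hz
        exact lt_irrefl _ hz
    have hg0 : ∀ᶠ z in 𝓝 (w : ℂ), g z = 0 :=
      hg.frequently_zero_iff_eventually_zero.1
        (((hfreq.and_eventually hgB).mono fun z h => h.2.trans h.1).filter_mono hle)
    have hB0 : ∀ᶠ z in 𝓝[Metric.ball (0 : ℂ) 1] (w : ℂ), blaschkeProd c p a z = 0 := by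
      filter_upwards [hgB, mem_nhdsWithin_of_mem_nhds hg0, eventually_eq_blaschkeProd hB w]
        with z h1 h2 h3
      rw [h3, ← h1, h2]
    obtain ⟨ε, hε, h⟩ := Metric.mem_nhdsWithin_iff.1 hB0
    obtain ⟨z, hz, hzw⟩ := Metric.mem_closure_iff.1 (Circle.coe_mem_closure_ball w) ε hε
    have hzero : blaschkeProd c p a =ᶠ[𝓝 z] 0 := by
      filter_upwards [(Metric.isOpen_ball.inter Metric.isOpen_ball).mem_nhds
        (show z ∈ Metric.ball (w : ℂ) ε ∩ Metric.ball 0 1 from ⟨Metric.mem_ball'.2 hzw, hz⟩)]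
        with y hy using h hy
    have hana : AnalyticOnNhd ℂ (blaschkeProd c p a) (Metric.ball 0 1) := fun y hy =>
      analyticAt_blaschkeProd c p ha hs (ball_subset_factorDomain (fun k => (ha k).2) hy)
    have := hana.eqOn_zero_of_preconnected_of_eventuallyEq_zero
      (convex_ball (0 : ℂ) 1).isPreconnected hz hzero
    obtain ⟨y, hy, hy0⟩ := exists_blaschkeProd_ne_zero hc p ha hs
    exact hy0 (this hy)
  · exact not_not.2 ⟨blaschkeProd c p a, analyticAt_blaschkeProd c p ha hs hw,
      eventually_eq_blaschkeProd hB w⟩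

lemma boundaryValue_eq_blaschkeProd {ι : Type} {a : ι → ℂ} {c : ℂ} {p : ℕ}
    (ha : ∀ k, 0 < ‖a k‖ ∧ ‖a k‖ < 1) (hs : Summable fun k => 1 - ‖a k‖) {B : ℂ → ℂ}
    (hB : ∀ z ∈ Metric.ball (0 : ℂ) 1, B z = blaschkeProd c p a z) {w : Circle}
    (hw : (w : ℂ) ∈ factorDomain a) : boundaryValue B w = blaschkeProd c p a w := by
  refine extendFrom_eq (Circle.coe_mem_closure_ball w) ?_
  have h : Tendsto (blaschkeProd c p a) (𝓝[Metric.ball (0 : ℂ) 1] (w : ℂ))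
      (𝓝 (blaschkeProd c p a w)) :=
    (differentiableAt_blaschkeProd c p ha hs hw).continuousAt.continuousWithinAt
  exact h.congr' (eventually_eq_blaschkeProd hB w)

/-- Zeros accumulating at `w` in a Stolz region occur with infinitely many indices. -/
lemma exists_finset_stolz {ι : Type} {a : ι → ℂ} {c : ℂ} (hc : ‖c‖ = 1) {p : ℕ}
    (ha : ∀ k, 0 < ‖a k‖ ∧ ‖a k‖ < 1) (hs : Summable fun k => 1 - ‖a k‖) {B : ℂ → ℂ}
    (hB : ∀ z ∈ Metric.ball (0 : ℂ) 1, B z = blaschkeProd c p a z) {w : Circle} {α : ℝ}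
    (hw : (w : ℂ) ∈ closure (discZeros B ∩ stolzRegion α w)) {ε : ℝ} (hε : 0 < ε) (n : ℕ) :
    ∃ s : Finset ι, s.card = n ∧ ∀ k ∈ s,
      1 - ‖a k‖ < ε ∧ ‖(w : ℂ) - a k‖ < α * (1 - ‖a k‖) := by
  set K : Set ι := {k | 1 - ‖a k‖ < ε ∧ ‖(w : ℂ) - a k‖ < α * (1 - ‖a k‖)} with hK
  suffices h : K.Infinite by
    obtain ⟨s, hs1, hs2⟩ := h.exists_subset_card_eq n
    exact ⟨s, hs2, fun k hk => hs1 hk⟩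
  -- A finite set of zeros is closed and lies in the open disc, whereas `w` is in its closure and
  -- has modulus 1.
  intro hfin
  have hcl : (w : ℂ) ∈ closure (a '' K) := by
    rw [Metric.mem_closure_iff]
    intro η hη
    -- The three bounds give, in turn, closeness to `w`, the condition 1 - |z| < ε, and z ≠ 0, which
    -- excludes the zero of `z ^ p`.
    obtain ⟨z, ⟨⟨hzb, hz0⟩, -, hzs⟩, hzd⟩ := Metric.mem_closure_iff.1 hw (min η (min ε 1))
      (lt_min hη (lt_min hε one_pos))
    rw [dist_eq_norm] at hzd
    have hn := norm_sub_norm_le (w : ℂ) z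
    rw [Circle.norm_coe] at hn
    have hzne : z ≠ 0 := by
      rintro rfl
      have := hzd.trans_le ((min_le_right _ _).trans (min_le_right _ _))
      rw [sub_zero, Circle.norm_coe] at this
      exact lt_irrefl _ this
    obtain ⟨k, rfl⟩ := exists_eq_of_blaschkeProd_eq_zero hc p ha hs
      (ball_subset_factorDomain (fun k => (ha k).2) hzb) hzne ((hB z hzb).symm.trans hz0)
    refine ⟨a k, ⟨k, ⟨?_, hzs⟩, rfl⟩, ?_⟩
    · exact hn.trans_lt (hzd.trans_le ((min_le_right _ _).trans (min_le_left _ _)))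
    · rw [dist_eq_norm]; exact hzd.trans_le (min_le_left _ _)
  rw [(hfin.image a).isClosed.closure_eq] at hcl
  obtain ⟨k, -, hk⟩ := hcl
  have := (ha k).2
  rw [hk, Circle.norm_coe] at this
  exact lt_irrefl _ this

/-! ### Growth of the argument caused by zeros in Stolz regions. -/

lemma norm_circleExp_sub_le (s t : ℝ) : ‖(Circle.exp s : ℂ) - Circle.exp t‖ ≤ |s - t| := by
  have h : (Circle.exp s : ℂ) - Circle.exp t
      = Circle.exp t * (Complex.exp (Complex.I * ((s - t : ℝ) : ℂ)) - 1) := by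
    rw [mul_sub, mul_one, Circle.coe_exp, Circle.coe_exp, ← Complex.exp_add]
    congr 2
    push_cast
    ring
  rw [h, norm_mul, Circle.norm_coe, one_mul]
  exact Real.norm_exp_I_mul_ofReal_sub_one_le

lemma continuous_diskPoisson_circleExp {a : ℂ} (ha : ‖a‖ < 1) :
    Continuous fun s : ℝ => diskPoisson a (Circle.exp s) := by
  unfold diskPoisson
  refine continuous_const.div (by fun_prop) fun s => ?_
  have : (Circle.exp s : ℂ) - a ≠ 0 := by
    refine sub_ne_zero.2 fun h => ?_
    rw [← h, Circle.norm_coe] at ha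
    exact lt_irrefl _ ha
  simpa using this

lemma le_diskPoisson_of_stolz {a : ℂ} (ha1 : ‖a‖ < 1) {α θ s : ℝ} (hα : 0 < α)
    (hst : ‖(Circle.exp θ : ℂ) - a‖ < α * (1 - ‖a‖)) (hsθ : |s - θ| ≤ 1 - ‖a‖) :
    1 / ((1 + α) ^ 2 * (1 - ‖a‖)) ≤ diskPoisson a (Circle.exp s) := by
  have h1 : ‖(Circle.exp s : ℂ) - a‖ ≤ (1 + α) * (1 - ‖a‖) := by
    have := norm_sub_le_norm_sub_add_norm_sub (Circle.exp s : ℂ) (Circle.exp θ) a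
    linarith [norm_circleExp_sub_le s θ]
  have h0 : 0 < ‖(Circle.exp s : ℂ) - a‖ := by
    refine norm_pos_iff.2 (sub_ne_zero.2 fun h => ?_)
    rw [← h, Circle.norm_coe] at ha1
    exact lt_irrefl _ ha1
  have h2 : ‖(Circle.exp s : ℂ) - a‖ ^ 2 ≤ ((1 + α) * (1 - ‖a‖)) ^ 2 := by gcongr
  have h3 : 0 < 1 - ‖a‖ := by linarith
  rw [diskPoisson, div_le_div_iff₀ (by positivity) (by positivity), one_mul]
  refine h2.trans ?_
  have := norm_nonneg a
  have h4 : 1 - ‖a‖ ≤ 1 - ‖a‖ ^ 2 := by nlinarith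
  calc ((1 + α) * (1 - ‖a‖)) ^ 2 = (1 - ‖a‖) * ((1 + α) ^ 2 * (1 - ‖a‖)) := by ring
    _ ≤ _ := by gcongr

/-- The kernel is at least of order 1/(1 - |a|) on a window of length (1 - |a|)/2, so the bound does
not depend on `a`. The window may lie on either side of `θ`, so a zero near a singularity counts for
both adjacent arcs. -/
lemma le_integral_diskPoisson_of_stolz {a : ℂ} (ha1 : ‖a‖ < 1) {α θ u v x : ℝ} (hα : 0 < α)
    (hst : ‖(Circle.exp θ : ℂ) - a‖ < α * (1 - ‖a‖)) (hu : u ≤ x)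
    (hv : x + (1 - ‖a‖) / 2 ≤ v) (hx1 : θ - (1 - ‖a‖) ≤ x)
    (hx2 : x + (1 - ‖a‖) / 2 ≤ θ + (1 - ‖a‖)) :
    1 / (2 * (1 + α) ^ 2) ≤ ∫ s in u..v, diskPoisson a (Circle.exp s) := by
  have h3 : 0 < 1 - ‖a‖ := by linarith
  have hcont := continuous_diskPoisson_circleExp ha1
  have h1 : ∫ s in x..(x + (1 - ‖a‖) / 2), diskPoisson a (Circle.exp s) ≤
      ∫ s in u..v, diskPoisson a (Circle.exp s) :=
    intervalIntegral.integral_mono_interval hu (by linarith) hv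
      (Eventually.of_forall fun s => (diskPoisson_pos ha1 (Circle.norm_coe _)).le)
      (hcont.intervalIntegrable _ _)
  refine le_trans ?_ h1
  have h2 := intervalIntegral.integral_mono_on (μ := MeasureTheory.volume) (a := x) (b := x + (1 - ‖a‖) / 2) (by linarith)
    ((continuous_const (y := 1 / ((1 + α) ^ 2 * (1 - ‖a‖)))).intervalIntegrable _ _)
    (hcont.intervalIntegrable _ _) (fun s hs => le_diskPoisson_of_stolz ha1 hα hst
      (abs_le.2 ⟨by linarith [hs.1], by linarith [hs.2]⟩))
  refine le_trans (le_of_eq ?_) h2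
  rw [intervalIntegral.integral_const, smul_eq_mul]
  field_simp
  ring

/-- The derivative of the argument of a Blaschke product along the circle. -/
noncomputable def phaseDeriv {ι : Type} (p : ℕ) (a : ι → ℂ) (s : ℝ) : ℝ :=
  p + ∑' k, diskPoisson (a k) (Circle.exp s)

section
variable {ι : Type} {a : ι → ℂ} {c : ℂ} {p : ℕ}

lemma sum_le_phaseDeriv (p : ℕ) (ha : ∀ k, 0 < ‖a k‖ ∧ ‖a k‖ < 1)
    (hs : Summable fun k => 1 - ‖a k‖) {s : ℝ}
    (hz : (Circle.exp s : ℂ) ∈ factorDomain a) (S : Finset ι) :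
    ∑ k ∈ S, diskPoisson (a k) (Circle.exp s) ≤ phaseDeriv p a s := by
  have h := (summable_diskPoisson ha hs hz (Circle.norm_coe _)).sum_le_tsum S
    fun k _ => (diskPoisson_pos (ha k).2 (Circle.norm_coe _)).le
  have : (0 : ℝ) ≤ p := p.cast_nonneg
  unfold phaseDeriv
  linarith

lemma hasDerivAt_circleExp_coe (s : ℝ) :
    HasDerivAt (fun s : ℝ => (Circle.exp s : ℂ)) (Circle.exp s * Complex.I) s := by
  simp only [Circle.coe_exp]
  simpa using ((Complex.ofRealCLM.hasDerivAt (x := s)).mul_const Complex.I).cexp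

lemma blaschkeProd_ne_zero_of_norm_one (hc : ‖c‖ = 1) (p : ℕ)
    (ha : ∀ k, 0 < ‖a k‖ ∧ ‖a k‖ < 1) (hs : Summable fun k => 1 - ‖a k‖) {z : ℂ}
    (hz : z ∈ factorDomain a) (hz1 : ‖z‖ = 1) : blaschkeProd c p a z ≠ 0 := by
  rw [← norm_pos_iff, norm_blaschkeProd_of_norm_one hc p ha hs hz hz1]
  exact one_pos

lemma hasDerivAt_blaschkeProd_circleExp (hc : ‖c‖ = 1) (p : ℕ)
    (ha : ∀ k, 0 < ‖a k‖ ∧ ‖a k‖ < 1) (hs : Summable fun k => 1 - ‖a k‖) {s : ℝ}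
    (hz : (Circle.exp s : ℂ) ∈ factorDomain a) :
    HasDerivAt (fun s : ℝ => blaschkeProd c p a (Circle.exp s))
      (blaschkeProd c p a (Circle.exp s) * (phaseDeriv p a s * Complex.I)) s := by
  have h := (differentiableAt_blaschkeProd c p ha hs hz).hasDerivAt.comp s
    (hasDerivAt_circleExp_coe s)
  have h1 := mul_logDeriv_blaschkeProd hc p ha hs hz (Circle.norm_coe _)
  have h0 := blaschkeProd_ne_zero_of_norm_one hc p ha hs hz (Circle.norm_coe _)
  refine h.congr_deriv ?_
  rw [phaseDeriv, ← h1, logDeriv_apply]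
  field_simp

lemma continuousOn_phaseDeriv (p : ℕ)
    (ha : ∀ k, 0 < ‖a k‖ ∧ ‖a k‖ < 1) (hs : Summable fun k => 1 - ‖a k‖) {u v : ℝ}
    (hz : ∀ s ∈ Ioo u v, (Circle.exp s : ℂ) ∈ factorDomain a) :
    ContinuousOn (phaseDeriv p a) (Ioo u v) := by
  intro s hs'
  -- The phase derivative does not involve the constant `c`, so it is the real part of z B'/B for
  -- the product with `c = 1`; continuity follows from analyticity.
  have hc : ‖(1 : ℂ)‖ = 1 := norm_one
  have han := analyticAt_blaschkeProd 1 p ha hs (hz s hs')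
  have h0 := blaschkeProd_ne_zero_of_norm_one hc p ha hs (hz s hs') (Circle.norm_coe _)
  have h1 : ContinuousAt (fun z => (z * logDeriv (blaschkeProd 1 p a) z).re)
      (Circle.exp s : ℂ) :=
    Complex.continuous_re.continuousAt.comp
      (continuousAt_id.mul (han.deriv.continuousAt.div han.continuousAt h0))
  have h2 : ContinuousAt (fun s : ℝ => (Circle.exp s : ℂ)) s :=
    (hasDerivAt_circleExp_coe s).continuousAt
  have h3 := ContinuousAt.comp (f := fun s : ℝ => (Circle.exp s : ℂ)) h1 h2
  refine (h3.congr ?_).continuousWithinAt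
  filter_upwards [isOpen_Ioo.mem_nhds hs'] with y hy
  simp only [Function.comp_apply]
  rw [mul_logDeriv_blaschkeProd hc p ha hs (hz y hy) (Circle.norm_coe _), Complex.ofReal_re]
  rfl

lemma intervalIntegrable_phaseDeriv (p : ℕ)
    (ha : ∀ k, 0 < ‖a k‖ ∧ ‖a k‖ < 1) (hs : Summable fun k => 1 - ‖a k‖) {u v x y : ℝ}
    (hz : ∀ s ∈ Ioo u v, (Circle.exp s : ℂ) ∈ factorDomain a) (hx : x ∈ Ioo u v)
    (hy : y ∈ Ioo u v) : IntervalIntegrable (phaseDeriv p a) MeasureTheory.volume x y :=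
  ((continuousOn_phaseDeriv p ha hs hz).mono
    (ordConnected_Ioo.uIcc_subset hx hy)).intervalIntegrable

lemma card_mul_le_integral_phaseDeriv (p : ℕ)
    (ha : ∀ k, 0 < ‖a k‖ ∧ ‖a k‖ < 1) (hs : Summable fun k => 1 - ‖a k‖) {u v x y : ℝ}
    (hz : ∀ s ∈ Ioo u v, (Circle.exp s : ℂ) ∈ factorDomain a) (hx : x ∈ Ioo u v)
    (hy : y ∈ Ioo u v) (hxy : x ≤ y) (S : Finset ι) {δ : ℝ}
    (hS : ∀ k ∈ S, δ ≤ ∫ s in x..y, diskPoisson (a k) (Circle.exp s)) :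
    S.card * δ ≤ ∫ s in x..y, phaseDeriv p a s := by
  calc (S.card : ℝ) * δ = ∑ k ∈ S, δ := by simp
    _ ≤ ∑ k ∈ S, ∫ s in x..y, diskPoisson (a k) (Circle.exp s) := Finset.sum_le_sum hS
    _ = ∫ s in x..y, ∑ k ∈ S, diskPoisson (a k) (Circle.exp s) :=
      (intervalIntegral.integral_finsetSum fun k _ =>
        (continuous_diskPoisson_circleExp (ha k).2).intervalIntegrable _ _).symm
    _ ≤ _ := by
      refine intervalIntegral.integral_mono_on hxy ?_
        (intervalIntegrable_phaseDeriv p ha hs hz hx hy) fun s hs' =>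
          sum_le_phaseDeriv p ha hs (hz s ⟨hx.1.trans_le hs'.1, hs'.2.trans_lt hy.2⟩) S
      exact (continuous_finsetSum _ fun k _ =>
        continuous_diskPoisson_circleExp (ha k).2).intervalIntegrable _ _

lemma exists_pos_forall_le_of_finset {f : ι → ℝ} (S : Finset ι) (hf : ∀ k ∈ S, 0 < f k) :
    ∃ η : ℝ, 0 < η ∧ ∀ k ∈ S, η ≤ f k := by
  rcases S.eq_empty_or_nonempty with rfl | hS
  · exact ⟨1, one_pos, by simp⟩
  · obtain ⟨k, hk, h⟩ := S.exists_min_image f hS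
    exact ⟨f k, hf k hk, h⟩

/-- Each of n zeros near exp(iv) contributes at least 1/(2(1 + α)²) from the window [v - (1 - |a|),
v - (1 - |a|)/2]. Taking ε = v - x starts all windows to the right of `x`, and `η` is small enough
that all of them end before v - η. -/
lemma exists_le_integral_right (p : ℕ)
    (ha : ∀ k, 0 < ‖a k‖ ∧ ‖a k‖ < 1) (hs : Summable fun k => 1 - ‖a k‖) {u v x α : ℝ}
    (hα : 0 < α) (hz : ∀ s ∈ Ioo u v, (Circle.exp s : ℂ) ∈ factorDomain a) (hx : x ∈ Ioo u v)
    (hv : ∀ ε > 0, ∀ n : ℕ, ∃ s : Finset ι, s.card = n ∧ ∀ k ∈ s,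
      1 - ‖a k‖ < ε ∧ ‖(Circle.exp v : ℂ) - a k‖ < α * (1 - ‖a k‖)) (M : ℝ) :
    ∃ y ∈ Ioo u v, M ≤ ∫ s in x..y, phaseDeriv p a s := by
  have hδ : (0 : ℝ) < 1 / (2 * (1 + α) ^ 2) := by positivity
  obtain ⟨n, hn⟩ := exists_nat_ge (M / (1 / (2 * (1 + α) ^ 2)))
  rw [div_le_iff₀ hδ] at hn
  obtain ⟨S, hS, h⟩ := hv (v - x) (sub_pos.2 hx.2) n
  obtain ⟨η, hη, hη'⟩ : ∃ η : ℝ, 0 < η ∧ ∀ k ∈ S, η ≤ (1 - ‖a k‖) / 2 :=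
    exists_pos_forall_le_of_finset S fun k _ => by
      have := (ha k).2
      linarith
  have hy : max x (v - η) ∈ Ioo u v :=
    ⟨hx.1.trans_le (le_max_left _ _), max_lt hx.2 (by linarith)⟩
  refine ⟨_, hy, hn.trans ?_⟩
  rw [← hS]
  refine card_mul_le_integral_phaseDeriv p ha hs hz hx hy (le_max_left _ _) S fun k hk => ?_
  have h1 := h k hk
  have h2 := hη' k hk
  have h3 := le_max_right x (v - η)
  have h4 := (ha k).2
  exact le_integral_diskPoisson_of_stolz (x := v - (1 - ‖a k‖)) (ha k).2 hα h1.2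
    (by linarith) (by linarith) le_rfl (by linarith)

/-- The mirror image, with the windows [u + (1 - |a|)/2, u + (1 - |a|)]. -/
lemma exists_le_integral_left (p : ℕ)
    (ha : ∀ k, 0 < ‖a k‖ ∧ ‖a k‖ < 1) (hs : Summable fun k => 1 - ‖a k‖) {u v x α : ℝ}
    (hα : 0 < α) (hz : ∀ s ∈ Ioo u v, (Circle.exp s : ℂ) ∈ factorDomain a) (hx : x ∈ Ioo u v)
    (hu : ∀ ε > 0, ∀ n : ℕ, ∃ s : Finset ι, s.card = n ∧ ∀ k ∈ s,
      1 - ‖a k‖ < ε ∧ ‖(Circle.exp u : ℂ) - a k‖ < α * (1 - ‖a k‖)) (M : ℝ) :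
    ∃ y ∈ Ioo u v, M ≤ ∫ s in y..x, phaseDeriv p a s := by
  have hδ : (0 : ℝ) < 1 / (2 * (1 + α) ^ 2) := by positivity
  obtain ⟨n, hn⟩ := exists_nat_ge (M / (1 / (2 * (1 + α) ^ 2)))
  rw [div_le_iff₀ hδ] at hn
  obtain ⟨S, hS, h⟩ := hu (x - u) (sub_pos.2 hx.1) n
  obtain ⟨η, hη, hη'⟩ : ∃ η : ℝ, 0 < η ∧ ∀ k ∈ S, η ≤ (1 - ‖a k‖) / 2 :=
    exists_pos_forall_le_of_finset S fun k _ => by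
      have := (ha k).2
      linarith
  have hy : min x (u + η) ∈ Ioo u v :=
    ⟨lt_min hx.1 (by linarith), (min_le_left _ _).trans_lt hx.2⟩
  refine ⟨_, hy, hn.trans ?_⟩
  rw [← hS]
  refine card_mul_le_integral_phaseDeriv p ha hs hz hy hx (min_le_left _ _) S fun k hk => ?_
  have h1 := h k hk
  have h2 := hη' k hk
  have h3 := min_le_right x (u + η)
  have h4 := (ha k).2
  exact le_integral_diskPoisson_of_stolz (x := u + (1 - ‖a k‖) / 2) (ha k).2 hα h1.2
    (by linarith) (by linarith) (by linarith) (by linarith)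

/-- A strictly increasing continuous function on an open interval that is unbounded in both
directions has a strictly increasing continuous inverse. -/
lemma exists_inverse_of_strictMonoOn {u v : ℝ} {φ : ℝ → ℝ} (hmono : StrictMonoOn φ (Ioo u v))
    (hcont : ContinuousOn φ (Ioo u v)) (htop : ∀ M, ∃ y ∈ Ioo u v, M ≤ φ y)
    (hbot : ∀ M, ∃ y ∈ Ioo u v, φ y ≤ M) :
    ∃ ψ : ℝ → ℝ, StrictMono ψ ∧ Continuous ψ ∧ range ψ = Ioo u v ∧ ∀ x, φ (ψ x) = x := by
  have hsurj : Function.Surjective fun s : Ioo u v => φ s := by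
    intro M
    obtain ⟨y₁, hy₁, h₁⟩ := hbot M
    obtain ⟨y₂, hy₂, h₂⟩ := htop M
    obtain ⟨y, hy, rfl⟩ := isPreconnected_Ioo.intermediate_value hy₁ hy₂ hcont ⟨h₁, h₂⟩
    exact ⟨⟨y, hy⟩, rfl⟩
  have hstrict : StrictMono fun s : Ioo u v => φ s := fun x y hxy => hmono x.2 y.2 hxy
  let e := hstrict.orderIsoOfSurjective _ hsurj
  refine ⟨fun x => e.symm x, fun x y hxy => e.symm.strictMono hxy,
    continuous_subtype_val.comp e.symm.continuous, ?_, fun x => e.apply_symm_apply x⟩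
  change range (Subtype.val ∘ e.symm) = _
  rw [range_comp, e.symm.surjective.range_eq, image_univ, Subtype.range_coe]

/-- The integral `φ` of the phase derivative is a continuous argument of the product on the arc,
increasing and unbounded in both directions; `ψ` is its inverse. -/
theorem exists_arc_parametrization (hc : ‖c‖ = 1) (p : ℕ)
    (ha : ∀ k, 0 < ‖a k‖ ∧ ‖a k‖ < 1) (hs : Summable fun k => 1 - ‖a k‖) {u v α β : ℝ}
    (huv : u < v) (hα : 0 < α) (hβ : 0 < β)
    (hz : ∀ s ∈ Ioo u v, (Circle.exp s : ℂ) ∈ factorDomain a)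
    (hu : ∀ ε > 0, ∀ n : ℕ, ∃ s : Finset ι, s.card = n ∧ ∀ k ∈ s,
      1 - ‖a k‖ < ε ∧ ‖(Circle.exp u : ℂ) - a k‖ < α * (1 - ‖a k‖))
    (hv : ∀ ε > 0, ∀ n : ℕ, ∃ s : Finset ι, s.card = n ∧ ∀ k ∈ s,
      1 - ‖a k‖ < ε ∧ ‖(Circle.exp v : ℂ) - a k‖ < β * (1 - ‖a k‖)) :
    ∃ ψ : ℝ → ℝ, StrictMono ψ ∧ Continuous ψ ∧ range ψ = Ioo u v ∧
      ∀ x, blaschkeProd c p a (Circle.exp (ψ x)) = Circle.exp x := by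
  -- One zero is needed for strict positivity of the phase derivative, since `p` may be 0.
  obtain ⟨k₀⟩ : Nonempty ι := by
    obtain ⟨S, hS, -⟩ := hu 1 one_pos 1
    obtain ⟨k, rfl⟩ := Finset.card_eq_one.1 hS
    exact ⟨k⟩
  obtain ⟨s₀, hs₀⟩ := nonempty_Ioo.2 huv
  set F : ℝ → ℂ := fun s => blaschkeProd c p a (Circle.exp s) with hF
  obtain ⟨θ, hθ⟩ : ∃ θ : ℝ, F s₀ = Complex.exp (θ * Complex.I) := by
    refine ⟨(F s₀).arg, ?_⟩
    have h1 : ‖F s₀‖ = 1 :=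
      norm_blaschkeProd_of_norm_one hc p ha hs (hz s₀ hs₀) (Circle.norm_coe _)
    have := Complex.norm_mul_exp_arg_mul_I (F s₀)
    rw [h1] at this
    simpa using this.symm
  set φ : ℝ → ℝ := fun s => θ + ∫ x in s₀..s, phaseDeriv p a x with hφ
  have hcont := continuousOn_phaseDeriv p ha hs hz
  have hderiv : ∀ s ∈ Ioo u v, HasDerivAt φ (phaseDeriv p a s) s := fun s hs' =>
    (intervalIntegral.integral_hasDerivAt_right
      (intervalIntegrable_phaseDeriv p ha hs hz hs₀ hs')
      (hcont.stronglyMeasurableAtFilter isOpen_Ioo s hs')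
      (hcont.continuousAt (isOpen_Ioo.mem_nhds hs'))).const_add θ
  have hpos : ∀ s ∈ Ioo u v, 0 < phaseDeriv p a s := fun s hs' => by
    have := sum_le_phaseDeriv p ha hs (hz s hs') {k₀}
    rw [Finset.sum_singleton] at this
    exact (diskPoisson_pos (ha k₀).2 (Circle.norm_coe _)).trans_le this
  have hφc : ContinuousOn φ (Ioo u v) := fun s hs' =>
    (hderiv s hs').continuousAt.continuousWithinAt
  have hmono : StrictMonoOn φ (Ioo u v) := by
    refine strictMonoOn_of_deriv_pos (convex_Ioo u v) hφc fun s hs' => ?_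
    rw [interior_Ioo] at hs'
    rw [(hderiv s hs').deriv]
    exact hpos s hs'
  have hFφ : ∀ s ∈ Ioo u v, F s = Complex.exp (φ s * Complex.I) := by
    -- The quotient of the product by exp(iφ) has derivative 0 on the arc, and it equals 1 at `s₀`
    -- by the choice of `θ`.
    have hG : ∀ s ∈ Ioo u v,
        HasDerivAt (fun s => F s * Complex.exp (-(φ s * Complex.I))) 0 s := by
      intro s hs'
      have h1 := hasDerivAt_blaschkeProd_circleExp hc p ha hs (hz s hs')
      have h2 := ((hderiv s hs').ofReal_comp.mul_const Complex.I).neg.cexp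
      refine (h1.mul h2).congr_deriv ?_
      ring
    intro s hs'
    have h3 := isOpen_Ioo.is_const_of_deriv_eq_zero isPreconnected_Ioo
      (fun y hy => (hG y hy).differentiableAt.differentiableWithinAt)
      (fun y hy => (hG y hy).deriv) hs' hs₀
    have h4 : φ s₀ = θ := by simp [hφ]
    simp only [h4] at h3
    rw [hθ, ← Complex.exp_add, add_neg_cancel, Complex.exp_zero, Complex.exp_neg] at h3
    exact (mul_inv_eq_one₀ (Complex.exp_ne_zero _)).1 h3
  obtain ⟨ψ, h1, h2, h3, h4⟩ := exists_inverse_of_strictMonoOn hmono hφc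
    (fun M => by
      obtain ⟨y, hy, h⟩ := exists_le_integral_right p ha hs hβ hz hs₀ hv (M - θ)
      exact ⟨y, hy, by simp only [hφ]; linarith⟩)
    (fun M => by
      obtain ⟨y, hy, h⟩ := exists_le_integral_left p ha hs hα hz hs₀ hu (θ - M)
      refine ⟨y, hy, ?_⟩
      simp only [hφ]
      rw [intervalIntegral.integral_symm]
      linarith)
  refine ⟨ψ, h1, h2, h3, fun x => ?_⟩
  have := hFφ (ψ x) (h3 ▸ mem_range_self x)
  rw [h4] at this
  rw [Circle.coe_exp x, ← this]

end

/-- Between consecutive singularities, the argument of `B` is a coordinate that runs through the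
whole real line. -/
theorem IsBlaschkeProduct.exists_arc_parametrization {B : ℂ → ℂ} (hB : IsBlaschkeProduct B)
    (hzeros : ∀ w ∈ singularities B, ∃ α : ℝ, 1 < α ∧
      (w : ℂ) ∈ closure (discZeros B ∩ stolzRegion α w)) {u v : ℝ} (huv : u < v)
    (hu : Circle.exp u ∈ singularities B) (hv : Circle.exp v ∈ singularities B)
    (hreg : ∀ s ∈ Ioo u v, Circle.exp s ∉ singularities B) :
    ∃ ψ : ℝ → ℝ, StrictMono ψ ∧ Continuous ψ ∧ range ψ = Ioo u v ∧
      ∀ x, boundaryValue B (Circle.exp (ψ x)) = Circle.exp x := by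
  obtain ⟨c, p, ι, a, hc, ha, hs, hBz⟩ := hB
  obtain ⟨α, hα, hαu⟩ := hzeros _ hu
  obtain ⟨β, hβ, hβv⟩ := hzeros _ hv
  have hz : ∀ s ∈ Ioo u v, (Circle.exp s : ℂ) ∈ factorDomain a := fun s hs' =>
    (notMem_singularities_iff hc ha hs hBz _).1 (hreg s hs')
  obtain ⟨ψ, h1, h2, h3, h4⟩ := _root_.exists_arc_parametrization hc p ha hs huv
    (one_pos.trans hα) (one_pos.trans hβ) hz
    (fun ε hε n => exists_finset_stolz hc ha hs hBz hαu hε n)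
    (fun ε hε n => exists_finset_stolz hc ha hs hBz hβv hε n)
  refine ⟨ψ, h1, h2, h3, fun x => ?_⟩
  rw [boundaryValue_eq_blaschkeProd ha hs hBz (hz _ (h3 ▸ mem_range_self x)), h4]

/-! ### Cyclic enumeration of the singularities and the arcs between them. -/

lemma exists_isCyclicEnumeration {S : Set Circle} {m : ℕ} (hm : 0 < m) (hS : S.ncard = m) :
    ∃ t, IsCyclicEnumeration S m t := by
  classical
  have hfin : S.Finite := finite_of_ncard_pos (hS ▸ hm)
  set A : Finset ℝ := hfin.toFinset.image fun w : Circle => Complex.arg w with hA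
  have hcard : A.card = m := by
    rw [hA, Finset.card_image_of_injective _ Circle.injective_arg, ← hS,
      ncard_eq_toFinset_card S hfin]
  have hAmem : ∀ s, s ∈ A ↔ ∃ w ∈ S, Complex.arg w = s := by simp [hA]
  have hbd : ∀ s ∈ A, s ∈ Ioc (-Real.pi) Real.pi := by
    intro s hs
    obtain ⟨w, -, rfl⟩ := (hAmem s).1 hs
    exact Complex.arg_mem_Ioc _
  have hm' : (0 : ℤ) < m := by exact_mod_cast hm
  have hmod : ∀ j : ℤ, (j % m).toNat < m := fun j => by
    have := Int.emod_lt_of_pos j hm'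
    have := Int.emod_nonneg j hm'.ne'
    omega
  set e := A.orderEmbOfFin hcard with he
  have hemem : ∀ i, e i ∈ A := fun i => Finset.orderEmbOfFin_mem A hcard i
  -- The m principal arguments in increasing order, translated by 2π for each full turn.
  set t : ℤ → ℝ := fun j => e ⟨(j % m).toNat, hmod j⟩ + 2 * Real.pi * (j / (m : ℤ) : ℤ) with ht
  have hexp : ∀ j, Circle.exp (t j) = Circle.exp (e ⟨(j % m).toNat, hmod j⟩) := fun j => by
    rw [ht, Circle.exp_add, Circle.exp_two_pi_mul_int, mul_one]
  refine ⟨t, strictMono_int_of_lt_succ fun j => ?_, fun j => ?_, ?_⟩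
  · have h0 := Int.emod_nonneg j hm'.ne'
    have h1 := Int.emod_lt_of_pos j hm'
    have h2 := Int.emod_add_mul_ediv j m
    by_cases h : j % m + 1 < m
    · have h3 : (j + 1) / m = j / m ∧ (j + 1) % m = j % m + 1 := by
        rw [Int.ediv_emod_unique hm']
        refine ⟨by linarith, by linarith, h⟩
      simp only [ht, h3.1]
      have : e ⟨(j % m).toNat, hmod j⟩ < e ⟨((j + 1) % m).toNat, hmod (j + 1)⟩ := by
        refine e.strictMono ?_
        rw [Fin.mk_lt_mk]
        omega
      linarith
    · have h3 : (j + 1) / m = j / m + 1 ∧ (j + 1) % m = 0 := by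
        rw [Int.ediv_emod_unique hm']
        refine ⟨?_, le_rfl, hm'⟩
        have : j % m = m - 1 := by omega
        rw [this] at h2
        linarith
      simp only [ht, h3.1]
      -- At the passage to the next turn the order is kept because all arguments lie in a half-open
      -- interval of length 2π.
      have h4 := hbd _ (hemem ⟨(j % m).toNat, hmod j⟩)
      have h5 := hbd _ (hemem ⟨((j + 1) % m).toNat, hmod (j + 1)⟩)
      push_cast
      linarith [h4.2, h5.1]
  · simp only [ht, Int.add_emod_right, Int.add_ediv_of_dvd_right (dvd_refl (m : ℤ)), Int.ediv_self hm'.ne']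
    push_cast
    ring
  · ext w
    constructor
    · rintro ⟨j, rfl⟩
      simp only [hexp]
      obtain ⟨w, hw, h⟩ := (hAmem _).1 (hemem ⟨(j % m).toNat, hmod j⟩)
      rw [← h, Circle.exp_arg]
      exact hw
    · intro hw
      have h1 : Complex.arg w ∈ (A : Set ℝ) := (hAmem _).2 ⟨w, hw, rfl⟩
      rw [← A.range_orderEmbOfFin hcard] at h1
      obtain ⟨i, hi⟩ := h1
      refine ⟨i, ?_⟩
      have h2 : ((i : ℤ) % m).toNat = i := by
        rw [Int.emod_eq_of_lt (by positivity) (by exact_mod_cast i.2), Int.toNat_natCast]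
      simp only [hexp, h2, Fin.eta, he, hi, Circle.exp_arg]

section
variable {S : Set Circle} {m : ℕ} {t : ℤ → ℝ}

lemma add_mul_period_of_add_period {g : ℤ → ℝ} {c : ℝ} {m : ℕ} (h : ∀ j, g (j + m) = g j + c)
    (j k : ℤ) : g (j + m * k) = g j + c * k := by
  induction k using Int.induction_on with
  | zero => simp
  | succ i ih =>
    rw [mul_add, mul_one, ← add_assoc, h, ih]
    push_cast
    ring
  | pred i ih =>
    have := h (j + m * (-i - 1))
    rw [show j + m * (-i - 1) + m = j + (m : ℤ) * -i by ring, ih] at this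
    push_cast at this ⊢
    linarith

lemma IsCyclicEnumeration.exp_mem_iff (h : IsCyclicEnumeration S m t) (s : ℝ) :
    Circle.exp s ∈ S ↔ s ∈ range t := by
  rw [← h.range_eq]
  constructor
  · rintro ⟨j, hj⟩
    obtain ⟨k, hk⟩ := Circle.exp_eq_exp.1 hj.symm
    exact ⟨j + m * k, by rw [add_mul_period_of_add_period h.add_period, hk]; ring⟩
  · rintro ⟨j, rfl⟩
    exact ⟨j, rfl⟩

lemma IsCyclicEnumeration.exp_notMem (h : IsCyclicEnumeration S m t) {j : ℤ} {s : ℝ}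
    (hs : s ∈ Ioo (t j) (t (j + 1))) : Circle.exp s ∉ S := by
  rw [h.exp_mem_iff]
  rintro ⟨k, rfl⟩
  have h1 := h.strictMono.lt_iff_lt.1 hs.1
  have h2 := h.strictMono.lt_iff_lt.1 hs.2
  omega

lemma IsCyclicEnumeration.exists_mem_Ico (h : IsCyclicEnumeration S m t) (s : ℝ) :
    ∃ j, t j ≤ s ∧ s < t (j + 1) := by
  have hper := add_mul_period_of_add_period h.add_period 0
  have hπ : 0 < 2 * Real.pi := Real.two_pi_pos
  obtain ⟨a, ha⟩ := exists_int_lt ((s - t 0) / (2 * Real.pi))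
  obtain ⟨b, hb⟩ := exists_int_gt ((s - t 0) / (2 * Real.pi))
  rw [lt_div_iff₀ hπ] at ha
  rw [div_lt_iff₀ hπ] at hb
  obtain ⟨j, hj, hj'⟩ := Int.exists_greatest_of_bdd (P := fun j => t j ≤ s)
    ⟨0 + m * b, fun z hz => by
      have : t z < t (0 + m * b) := by rw [hper]; linarith
      exact (h.strictMono.lt_iff_lt.1 this).le⟩
    ⟨0 + m * a, by rw [hper]; linarith⟩
  refine ⟨j, hj, ?_⟩
  by_contra! hcon
  have := hj' _ hcon
  omega

end

/-- Parametrizations `ψ j` of the arcs between the singularities of `B` by the argument of `B`. -/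
structure IsArcSystem (B : ℂ → ℂ) (m : ℕ) (t : ℤ → ℝ) (ψ : ℤ → ℝ → ℝ) : Prop where
  enum : IsCyclicEnumeration (singularities B) m t
  strictMono : ∀ j, StrictMono (ψ j)
  continuous : ∀ j, Continuous (ψ j)
  range_eq : ∀ j, range (ψ j) = Ioo (t j) (t (j + 1))
  add_period : ∀ j u, ψ (j + m) u = ψ j u + 2 * Real.pi
  boundaryValue_exp : ∀ j u, boundaryValue B (Circle.exp (ψ j u)) = Circle.exp u

theorem IsBlaschkeProduct.exists_isArcSystem {B : ℂ → ℂ} (hB : IsBlaschkeProduct B) {m : ℕ}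
    (hm : 0 < m) (hcard : (singularities B).ncard = m)
    (hzeros : ∀ w ∈ singularities B, ∃ α : ℝ, 1 < α ∧
      (w : ℂ) ∈ closure (discZeros B ∩ stolzRegion α w)) : ∃ t ψ, IsArcSystem B m t ψ := by
  obtain ⟨t, ht⟩ := exists_isCyclicEnumeration hm hcard
  have hm' : (m : ℤ) ≠ 0 := by exact_mod_cast hm.ne'
  have hex : ∀ j : ℤ, ∃ ψ : ℝ → ℝ, StrictMono ψ ∧ Continuous ψ ∧
      range ψ = Ioo (t j) (t (j + 1)) ∧ ∀ u, boundaryValue B (Circle.exp (ψ u)) = Circle.exp u :=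
    fun j => hB.exists_arc_parametrization hzeros (ht.strictMono (lt_add_one j))
      ((ht.exp_mem_iff _).2 ⟨j, rfl⟩) ((ht.exp_mem_iff _).2 ⟨j + 1, rfl⟩)
      fun s hs => ht.exp_notMem hs
  choose ψ h1 h2 h3 h4 using hex
  -- Only the choices for the residues modulo m are kept and translated, which makes the
  -- parametrizations exactly periodic.
  refine ⟨t, fun j u => ψ (j % m) u + 2 * Real.pi * (j / (m : ℤ) : ℤ), ht,
    fun j => (h1 _).add_const _, fun j => (h2 _).add continuous_const, fun j => ?_,
    fun j u => ?_, fun j u => ?_⟩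
  · have hj : t j = t (j % m) + 2 * Real.pi * (j / (m : ℤ) : ℤ) := by
      rw [← add_mul_period_of_add_period ht.add_period, Int.emod_add_mul_ediv]
    have hj1 : t (j + 1) = t (j % m + 1) + 2 * Real.pi * (j / (m : ℤ) : ℤ) := by
      rw [← add_mul_period_of_add_period ht.add_period, add_right_comm, Int.emod_add_mul_ediv]
    rw [hj, hj1, ← image_add_const_Ioo, ← h3, ← range_comp]
    rfl
  · simp only [Int.add_emod_right, Int.add_ediv_of_dvd_right (dvd_refl (m : ℤ)), Int.ediv_self hm']
    push_cast
    ring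
  · rw [Circle.exp_add, Circle.exp_two_pi_mul_int, mul_one, h4]

/-! ### Argument coordinates on the line and on the circle. -/

/-- The point of the line with coordinate `v` on the arc number `j`; the coordinate `⊥` stands for
the initial end point of the arc. -/
noncomputable def arcPoint (t : ℤ → ℝ) (ψ : ℤ → ℝ → ℝ) (j : ℤ) (v : WithBot ℝ) : ℝ :=
  WithBot.recBotCoe (t j) (ψ j) v

/-- The point of the circle with coordinate `q.2` on the arc number `q.1`. -/
noncomputable def circlePoint (t : ℤ → ℝ) (ψ : ℤ → ℝ → ℝ) {m : ℕ} (q : ZMod m × WithBot ℝ) :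
    Circle :=
  Circle.exp (arcPoint t ψ (q.1.cast : ℤ) q.2)

@[simp] lemma arcPoint_bot (t : ℤ → ℝ) (ψ : ℤ → ℝ → ℝ) (j : ℤ) : arcPoint t ψ j ⊥ = t j := rfl

@[simp] lemma arcPoint_coe (t : ℤ → ℝ) (ψ : ℤ → ℝ → ℝ) (j : ℤ) (u : ℝ) :
    arcPoint t ψ j u = ψ j u := rfl

namespace IsArcSystem
variable {B : ℂ → ℂ} {m : ℕ} {t : ℤ → ℝ} {ψ : ℤ → ℝ → ℝ} (h : IsArcSystem B m t ψ)
include h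

lemma mem_Ioo (j : ℤ) (u : ℝ) : ψ j u ∈ Ioo (t j) (t (j + 1)) := h.range_eq j ▸ mem_range_self u

lemma arcPoint_mem_Ico (j : ℤ) (v : WithBot ℝ) : arcPoint t ψ j v ∈ Ico (t j) (t (j + 1)) := by
  induction v with
  | bot => exact ⟨le_rfl, h.enum.strictMono (lt_add_one j)⟩
  | coe u => exact Ioo_subset_Ico_self (h.mem_Ioo j u)

lemma arcPoint_strictMono (j : ℤ) : StrictMono (arcPoint t ψ j) := by
  intro v v' hv
  induction v' with
  | bot => exact absurd hv not_lt_bot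
  | coe u' =>
    induction v with
    | bot => exact (h.mem_Ioo j u').1
    | coe u => exact h.strictMono j (WithBot.coe_lt_coe.1 hv)

lemma arcPoint_add_mul (j k : ℤ) (v : WithBot ℝ) :
    arcPoint t ψ (j + m * k) v = arcPoint t ψ j v + 2 * Real.pi * k := by
  induction v with
  | bot => exact add_mul_period_of_add_period h.enum.add_period j k
  | coe u => exact add_mul_period_of_add_period (g := fun j => ψ j u) (h.add_period · u) j k

/-- The half-open arcs tile the line in order. This turns continuity questions into order questions.
-/
lemma strictMono_lex : StrictMono fun q : ℤ ×ₗ WithBot ℝ => arcPoint t ψ (ofLex q).1 (ofLex q).2 := by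
  intro q q' hq
  rcases Prod.Lex.lt_iff.1 hq with h1 | ⟨h1, h2⟩
  · exact (h.arcPoint_mem_Ico _ _).2.trans_le
      ((h.enum.strictMono.monotone (Int.add_one_le_iff.2 h1)).trans (h.arcPoint_mem_Ico _ _).1)
  · simp only [h1]
    exact h.arcPoint_strictMono _ h2

lemma exists_arcPoint_eq (s : ℝ) : ∃ j v, arcPoint t ψ j v = s := by
  obtain ⟨j, h1, h2⟩ := h.enum.exists_mem_Ico s
  rcases h1.eq_or_lt with rfl | h1
  · exact ⟨j, ⊥, rfl⟩
  · obtain ⟨u, hu⟩ := (h.range_eq j).symm ▸ (show s ∈ Ioo (t j) (t (j + 1)) from ⟨h1, h2⟩)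
    exact ⟨j, u, hu⟩

/-- The coordinates on the line are an order isomorphism. -/
noncomputable def lexOrderIso : ℤ ×ₗ WithBot ℝ ≃o ℝ :=
  h.strictMono_lex.orderIsoOfSurjective _ fun s => by
    obtain ⟨j, v, hs⟩ := h.exists_arcPoint_eq s
    exact ⟨toLex (j, v), hs⟩

lemma lexOrderIso_apply (j : ℤ) (v : WithBot ℝ) :
    h.lexOrderIso (toLex (j, v)) = arcPoint t ψ j v := rfl

lemma arcPoint_inj {j j' : ℤ} {v v' : WithBot ℝ} (he : arcPoint t ψ j v = arcPoint t ψ j' v') :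
    j = j' ∧ v = v' := by
  have : toLex (j, v) = toLex (j', v') := h.lexOrderIso.injective he
  simpa using this

lemma circlePoint_intCast (j : ℤ) (v : WithBot ℝ) :
    circlePoint t ψ ((j : ZMod m), v) = Circle.exp (arcPoint t ψ j v) := by
  rw [circlePoint, ZMod.coe_intCast]
  conv_rhs => rw [← Int.emod_add_mul_ediv j m, h.arcPoint_add_mul, Circle.exp_add,
    Circle.exp_two_pi_mul_int, mul_one]

lemma circlePoint_bijective : Function.Bijective (circlePoint t ψ (m := m)) := by
  constructor
  · rintro ⟨a, v⟩ ⟨a', v'⟩ hq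
    obtain ⟨j, rfl⟩ := ZMod.intCast_surjective a
    obtain ⟨j', rfl⟩ := ZMod.intCast_surjective a'
    rw [h.circlePoint_intCast, h.circlePoint_intCast] at hq
    obtain ⟨k, hk⟩ := Circle.exp_eq_exp.1 hq
    rw [mul_comm, ← h.arcPoint_add_mul] at hk
    obtain ⟨rfl, rfl⟩ := h.arcPoint_inj hk
    simp
  · intro w
    obtain ⟨s, rfl⟩ := Circle.exp_surjective w
    obtain ⟨j, v, rfl⟩ := h.exists_arcPoint_eq s
    exact ⟨((j : ZMod m), v), h.circlePoint_intCast j v⟩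

/-- The coordinates on the circle. -/
noncomputable def circleEquiv : ZMod m × WithBot ℝ ≃ Circle :=
  Equiv.ofBijective _ h.circlePoint_bijective

lemma circleEquiv_intCast (j : ℤ) (v : WithBot ℝ) :
    h.circleEquiv ((j : ZMod m), v) = Circle.exp (arcPoint t ψ j v) := h.circlePoint_intCast j v

lemma circleEquiv_bot_mem (a : ZMod m) : h.circleEquiv (a, ⊥) ∈ singularities B := by
  obtain ⟨j, rfl⟩ := ZMod.intCast_surjective a
  rw [h.circleEquiv_intCast]
  exact (h.enum.exp_mem_iff _).2 ⟨j, rfl⟩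

lemma circleEquiv_coe_notMem (a : ZMod m) (u : ℝ) :
    h.circleEquiv (a, u) ∉ singularities B := by
  obtain ⟨j, rfl⟩ := ZMod.intCast_surjective a
  rw [h.circleEquiv_intCast]
  exact h.enum.exp_notMem (h.mem_Ioo j u)

lemma circleEquiv_mem_iff (q : ZMod m × WithBot ℝ) :
    h.circleEquiv q ∈ singularities B ↔ q.2 = ⊥ := by
  obtain ⟨a, v⟩ := q
  induction v with
  | bot => simp [h.circleEquiv_bot_mem]
  | coe u => simp [h.circleEquiv_coe_notMem]

lemma boundaryValue_circleEquiv (a : ZMod m) (u : ℝ) :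
    boundaryValue B (h.circleEquiv (a, u)) = Circle.exp u := by
  obtain ⟨j, rfl⟩ := ZMod.intCast_surjective a
  rw [h.circleEquiv_intCast, arcPoint_coe, h.boundaryValue_exp]

lemma isOpenMap_arc (a : ZMod m) : IsOpenMap fun u : ℝ => h.circleEquiv (a, u) := by
  obtain ⟨j, rfl⟩ := ZMod.intCast_surjective a
  simp only [h.circleEquiv_intCast, arcPoint_coe]
  have h1 : IsEmbedding (ψ j) := (h.strictMono j).isEmbedding_of_ordConnected
    (by rw [h.range_eq]; exact ordConnected_Ioo)
  have h2 : IsOpenEmbedding (ψ j) := ⟨h1, by rw [h.range_eq]; exact isOpen_Ioo⟩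
  exact isLocalHomeomorph_circleExp.isOpenMap.comp h2.isOpenMap

lemma continuous_arc (a : ZMod m) : Continuous fun u : ℝ => h.circleEquiv (a, u) := by
  obtain ⟨j, rfl⟩ := ZMod.intCast_surjective a
  simp only [h.circleEquiv_intCast, arcPoint_coe]
  exact Circle.exp.continuous.comp (h.continuous j)

lemma isOpenEmbedding_arc (a : ZMod m) : IsOpenEmbedding fun u : ℝ => h.circleEquiv (a, u) :=
  .of_continuous_injective_isOpenMap (h.continuous_arc a)
    (fun u u' he => by simpa using h.circleEquiv.injective he) (h.isOpenMap_arc a)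

lemma tendsto_arc_atBot (a : ZMod m) :
    Tendsto (fun u : ℝ => h.circleEquiv (a, u)) atBot (𝓝 (h.circleEquiv (a, ⊥))) := by
  obtain ⟨j, rfl⟩ := ZMod.intCast_surjective a
  simp only [h.circleEquiv_intCast, arcPoint_coe, arcPoint_bot]
  refine (Circle.exp.continuous.tendsto _).comp (tendsto_atBot_isGLB (h.strictMono j).monotone ?_)
  rw [h.range_eq]
  exact isGLB_Ioo (h.enum.strictMono (lt_add_one j))

/-- The end of arc `a` is the initial point of arc `a + 1`; with the limit at `atBot` this links
neighbouring arcs. -/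
lemma tendsto_arc_atTop (a : ZMod m) :
    Tendsto (fun u : ℝ => h.circleEquiv (a, u)) atTop (𝓝 (h.circleEquiv (a + 1, ⊥))) := by
  obtain ⟨j, rfl⟩ := ZMod.intCast_surjective a
  have h1 : h.circleEquiv ((j : ZMod m) + 1, ⊥) = Circle.exp (t (j + 1)) := by
    have := h.circleEquiv_intCast (j + 1) ⊥
    push_cast at this
    exact this
  rw [h1]
  simp only [h.circleEquiv_intCast, arcPoint_coe]
  refine (Circle.exp.continuous.tendsto _).comp (tendsto_atTop_isLUB (h.strictMono j).monotone ?_)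
  rw [h.range_eq]
  exact isLUB_Ioo (h.enum.strictMono (lt_add_one j))

end IsArcSystem

/-! ### The action of the semidirect product and the determination of all invariants. -/

lemma ShiftRotationGroup.mul_left_apply {m : ℕ} (g g' : ShiftRotationGroup m) (a : ZMod m) :
    (g * g').left a = g.left a * g'.left (a - Multiplicative.toAdd g.right) := by
  rw [SemidirectProduct.mul_left, Pi.mul_apply, sub_eq_neg_add]
  rfl

/-- The action on coordinates: `(f, r)` takes the point with coordinate `v` on the arc `a` to the
point with coordinate `v + 2 π f (a + r)` on the arc `a + r`. -/
noncomputable def coordAction {m : ℕ} (g : ShiftRotationGroup m) (q : ZMod m × WithBot ℝ) :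
    ZMod m × WithBot ℝ :=
  (q.1 + Multiplicative.toAdd g.right,
    q.2 + ((2 * Real.pi * (Multiplicative.toAdd
      (g.left (q.1 + Multiplicative.toAdd g.right)) : ℤ) : ℝ) : WithBot ℝ))

lemma coordAction_one {m : ℕ} (q : ZMod m × WithBot ℝ) :
    coordAction (1 : ShiftRotationGroup m) q = q := by
  simp [coordAction]

/-- The shift is evaluated at the arc b reached after rotating, so composition gives f(b) + f'(b -
r), which is the semidirect multiplication. -/
lemma coordAction_mul {m : ℕ} (g g' : ShiftRotationGroup m) (q : ZMod m × WithBot ℝ) :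
    coordAction (g * g') q = coordAction g (coordAction g' q) := by
  have h : q.1 + Multiplicative.toAdd (g * g').right
      = q.1 + Multiplicative.toAdd g'.right + Multiplicative.toAdd g.right := by
    rw [SemidirectProduct.mul_right, toAdd_mul]
    abel
  refine Prod.ext h ?_
  simp only [coordAction, h, ShiftRotationGroup.mul_left_apply, add_sub_cancel_right]
  rw [add_assoc q.2, ← WithBot.coe_add, toAdd_mul]
  congr 2
  push_cast
  ring

namespace IsArcSystem
variable {B : ℂ → ℂ} {m : ℕ} {t : ℤ → ℝ} {ψ : ℤ → ℝ → ℝ} (h : IsArcSystem B m t ψ)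
include h

/-- The action of the shift-rotation group on the circle. -/
noncomputable def circleAction : ShiftRotationGroup m →* Function.End Circle where
  toFun g w := h.circleEquiv (coordAction g (h.circleEquiv.symm w))
  map_one' := by
    funext w
    rw [coordAction_one, Equiv.apply_symm_apply]
    rfl
  map_mul' g g' := by
    funext w
    rw [coordAction_mul]
    change _ = h.circleEquiv (coordAction g (h.circleEquiv.symm
      (h.circleEquiv (coordAction g' (h.circleEquiv.symm w)))))
    rw [Equiv.symm_apply_apply]

lemma circleAction_apply (g : ShiftRotationGroup m) (q : ZMod m × WithBot ℝ) :
    h.circleAction g (h.circleEquiv q) = h.circleEquiv (coordAction g q) := by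
  change h.circleEquiv (coordAction g (h.circleEquiv.symm (h.circleEquiv q))) = _
  rw [Equiv.symm_apply_apply]

/-- A map of the circle that lifts to a shift of coordinates on the line is continuous. -/
lemma continuous_of_lift {x : Circle → Circle} (r : ℤ) (n : ℤ → ℝ)
    (hx : ∀ j v, x (Circle.exp (arcPoint t ψ j v))
      = Circle.exp (arcPoint t ψ (j + r) (v + (n j : WithBot ℝ)))) : Continuous x := by
  -- The shift is an order automorphism of the lexicographic coordinates, hence of ℝ, hence
  -- continuous; no estimate at the singularities is needed.
  have hmono : StrictMono fun q : ℤ ×ₗ WithBot ℝ =>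
      (toLex ((ofLex q).1 + r, (ofLex q).2 + (n (ofLex q).1 : WithBot ℝ)) : ℤ ×ₗ WithBot ℝ) := by
    intro q q' hq
    rw [Prod.Lex.lt_iff] at hq ⊢
    rcases hq with h1 | ⟨h1, h2⟩
    · exact Or.inl (add_lt_add_left h1 r)
    · refine Or.inr ⟨by simp [h1], ?_⟩
      simp only [ofLex_toLex, h1]
      generalize (ofLex q').1 = j at *
      generalize (ofLex q).2 = v at *
      generalize (ofLex q').2 = v' at *
      exact WithBot.add_lt_add_right WithBot.coe_ne_bot h2
  have hsurj : Function.Surjective fun q : ℤ ×ₗ WithBot ℝ =>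
      (toLex ((ofLex q).1 + r, (ofLex q).2 + (n (ofLex q).1 : WithBot ℝ)) : ℤ ×ₗ WithBot ℝ) := by
    intro q
    refine ⟨toLex ((ofLex q).1 - r, (ofLex q).2 + ((-n ((ofLex q).1 - r) : ℝ) : WithBot ℝ)), ?_⟩
    simp only [ofLex_toLex, sub_add_cancel]
    rw [add_assoc, ← WithBot.coe_add, neg_add_cancel, WithBot.coe_zero, add_zero]
    rfl
  let X : ℤ ×ₗ WithBot ℝ ≃o ℤ ×ₗ WithBot ℝ := hmono.orderIsoOfSurjective _ hsurj
  let Y : ℝ ≃o ℝ := (h.lexOrderIso.symm.trans X).trans h.lexOrderIso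
  have hq : IsQuotientMap Circle.exp :=
    isLocalHomeomorph_circleExp.isOpenMap.isQuotientMap Circle.exp.continuous
      Circle.exp_surjective
  rw [hq.continuous_iff]
  have hY : x ∘ Circle.exp = Circle.exp ∘ Y := by
    funext s
    obtain ⟨j, v, rfl⟩ := h.exists_arcPoint_eq s
    have hs : h.lexOrderIso.symm (arcPoint t ψ j v) = toLex (j, v) := by
      rw [← h.lexOrderIso_apply, OrderIso.symm_apply_apply]
    change x (Circle.exp (arcPoint t ψ j v))
      = Circle.exp (h.lexOrderIso (X (h.lexOrderIso.symm (arcPoint t ψ j v))))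
    rw [hs, hx]
    rfl
  rw [hY]
  exact Circle.exp.continuous.comp Y.continuous

lemma circleAction_mem (g : ShiftRotationGroup m) : h.circleAction g ∈ invariants B := by
  refine ⟨?_, fun w => ?_, fun w hw => ?_⟩
  · refine h.continuous_of_lift (Multiplicative.toAdd g.right).cast
      (fun j => 2 * Real.pi * (Multiplicative.toAdd
        (g.left ((j : ZMod m) + Multiplicative.toAdd g.right)) : ℤ)) fun j v => ?_
    rw [← h.circleEquiv_intCast, h.circleAction_apply, ← h.circleEquiv_intCast, coordAction,
      Int.cast_add, ZMod.intCast_zmod_cast]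
  · obtain ⟨q, rfl⟩ := h.circleEquiv.surjective w
    rw [h.circleAction_apply, h.circleEquiv_mem_iff, h.circleEquiv_mem_iff, coordAction,
      WithBot.add_eq_bot, or_iff_left (WithBot.coe_ne_bot)]
  · obtain ⟨⟨a, v⟩, rfl⟩ := h.circleEquiv.surjective w
    induction v with
    | bot => exact absurd (h.circleEquiv_bot_mem a) hw
    | coe u =>
      rw [h.circleAction_apply, coordAction, ← WithBot.coe_add, h.boundaryValue_circleEquiv,
        h.boundaryValue_circleEquiv, Circle.exp_add, Circle.exp_two_pi_mul_int, mul_one]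

lemma circleAction_injective : Function.Injective h.circleAction := by
  intro g g' hg
  have key : ∀ q, coordAction g q = coordAction g' q := fun q =>
    h.circleEquiv.injective (by
      rw [← h.circleAction_apply, ← h.circleAction_apply, hg])
  have hr : g.right = g'.right := by
    have := congrArg Prod.fst (key (0, ⊥))
    simpa [coordAction] using this
  refine SemidirectProduct.ext (funext fun a => ?_) hr
  -- The point with coordinate 0 on arc `a - r` lands on arc `a`, and its new coordinate reveals the
  -- value of f at `a`.
  have := congrArg Prod.snd (key (a - Multiplicative.toAdd g.right, ((0 : ℝ) : WithBot ℝ)))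
  simp only [coordAction, ← hr, sub_add_cancel, ← WithBot.coe_add, zero_add, WithBot.coe_inj] at this
  have h2 := mul_left_cancel₀ Real.two_pi_pos.ne' this
  exact Multiplicative.toAdd.injective (by exact_mod_cast h2)

/-- On each arc an invariant is a translation in the coordinates. -/
lemma exists_shift_on_arc {x : Circle → Circle} (hx : Continuous x)
    (hxs : ∀ w, x w ∈ singularities B ↔ w ∈ singularities B)
    (hxB : ∀ w, w ∉ singularities B → boundaryValue B (x w) = boundaryValue B w) (a : ZMod m) :
    ∃ (b : ZMod m) (n : ℤ), ∀ u : ℝ, x (h.circleEquiv (a, u))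
      = h.circleEquiv (b, ((u + 2 * Real.pi * n : ℝ) : WithBot ℝ)) := by
  have hex : ∀ u : ℝ, ∃ (b : ZMod m) (y : ℝ), x (h.circleEquiv (a, u)) = h.circleEquiv (b, y) := by
    intro u
    obtain ⟨⟨b, v⟩, hq⟩ := h.circleEquiv.surjective (x (h.circleEquiv (a, u)))
    induction v with
    | bot =>
      exact absurd ((hxs _).1 (hq ▸ h.circleEquiv_bot_mem b)) (h.circleEquiv_coe_notMem a u)
    | coe y => exact ⟨b, y, hq.symm⟩
  choose β y hβ using hex
  have hcont : Continuous fun u : ℝ => x (h.circleEquiv (a, u)) := hx.comp (h.continuous_arc a)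
  -- The open arcs are open in the circle, so the index of the arc that contains the image cannot
  -- jump.
  have hloc : IsLocallyConstant β := by
    rw [IsLocallyConstant.iff_isOpen_fiber]
    intro b
    have : β ⁻¹' {b} = (fun u : ℝ => x (h.circleEquiv (a, u))) ⁻¹'
        range fun u : ℝ => h.circleEquiv (b, u) := by
      ext u
      simp only [mem_preimage, mem_singleton_iff, mem_range, hβ]
      constructor
      · rintro rfl
        exact ⟨y u, rfl⟩
      · rintro ⟨u', hu'⟩
        exact (congrArg Prod.fst (h.circleEquiv.injective hu')).symm
    rw [this]
    exact (h.isOpenEmbedding_arc b).isOpen_range.preimage hcont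
  obtain ⟨b, rfl⟩ : ∃ b, β = fun _ => b :=
    ⟨β 0, funext fun u => hloc.apply_eq_of_isPreconnected isPreconnected_univ trivial trivial⟩
  have hy : Continuous y := by
    rw [(h.isOpenEmbedding_arc b).isInducing.continuous_iff]
    exact hcont.congr hβ
  have hn : ∀ u, ∃ n : ℤ, y u = u + n * (2 * Real.pi) := fun u => by
    have h1 := hxB _ (h.circleEquiv_coe_notMem a u)
    rw [hβ, h.boundaryValue_circleEquiv, h.boundaryValue_circleEquiv] at h1
    exact Circle.exp_eq_exp.1 (Circle.coe_injective h1)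
  -- The displacement is a continuous integer multiple of 2π on a connected line, hence constant.
  choose n hn using hn
  have hnc : Continuous n := by
    rw [Int.isClosedEmbedding_coe_real.isInducing.continuous_iff]
    refine ((hy.sub continuous_id).div_const (2 * Real.pi)).congr fun u => ?_
    simp only [Pi.sub_apply, id, Function.comp_apply, hn u]
    field_simp
    ring
  refine ⟨b, n 0, fun u => ?_⟩
  rw [hβ, hn u, PreconnectedSpace.constant inferInstance hnc (x := u) (y := 0), mul_comm]

/-- The common end point of arcs `a` and `a + 1` has one image, computed as a limit from each side;
this forces β(a + 1) = β(a) + 1, so β is a rotation. -/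
lemma exists_circleAction_eq [NeZero m] {x : Circle → Circle} (hx : Continuous x)
    (hxs : ∀ w, x w ∈ singularities B ↔ w ∈ singularities B)
    (hxB : ∀ w, w ∉ singularities B → boundaryValue B (x w) = boundaryValue B w) :
    ∃ g, h.circleAction g = x := by
  choose β n hβ using h.exists_shift_on_arc hx hxs hxB
  have hbot : ∀ a, x (h.circleEquiv (a, ⊥)) = h.circleEquiv (β a, ⊥) := fun a => by
    refine tendsto_nhds_unique ((hx.tendsto _).comp (h.tendsto_arc_atBot a)) ?_
    exact ((h.tendsto_arc_atBot (β a)).comp (tendsto_atBot_add_const_right _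
      (2 * Real.pi * n a) tendsto_id)).congr fun u => (hβ a u).symm
  have htop : ∀ a, x (h.circleEquiv (a + 1, ⊥)) = h.circleEquiv (β a + 1, ⊥) := fun a => by
    refine tendsto_nhds_unique ((hx.tendsto _).comp (h.tendsto_arc_atTop a)) ?_
    exact ((h.tendsto_arc_atTop (β a)).comp (tendsto_atTop_add_const_right _
      (2 * Real.pi * n a) tendsto_id)).congr fun u => (hβ a u).symm
  have hsucc : ∀ a, β (a + 1) = β a + 1 := fun a =>
    congrArg Prod.fst (h.circleEquiv.injective ((hbot (a + 1)).symm.trans (htop a)))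
  have hnat : ∀ k : ℕ, β k = k + β 0 := by
    intro k
    induction k with
    | zero => simp
    | succ k ih =>
      push_cast
      rw [hsucc, ih]
      abel
  have hall : ∀ a, β a = a + β 0 := fun a => by
    rw [← ZMod.natCast_zmod_val a, hnat, ZMod.natCast_zmod_val]
  -- The shift is indexed by the target arc `b`, whose source is `b - β 0`.
  refine ⟨⟨fun b => Multiplicative.ofAdd (n (b - β 0)), Multiplicative.ofAdd (β 0)⟩,
    funext fun w => ?_⟩
  obtain ⟨⟨a, v⟩, rfl⟩ := h.circleEquiv.surjective w
  rw [h.circleAction_apply]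
  induction v with
  | bot => simp [coordAction, hbot, hall a]
  | coe u =>
    rw [hβ, hall a]
    simp [coordAction]

/-- The invariants form the shift-rotation group. -/
noncomputable def invariantsEquiv [NeZero m] : ShiftRotationGroup m ≃* invariants B :=
  MulEquiv.ofBijective (h.circleAction.codRestrict (invariants B) h.circleAction_mem)
    ⟨fun _ _ hg => h.circleAction_injective (congrArg Subtype.val hg), fun x => by
      obtain ⟨g, hg⟩ := h.exists_circleAction_eq x.2.1 x.2.2.1 x.2.2.2
      exact ⟨g, Subtype.ext hg⟩⟩

lemma invariantsEquiv_apply [NeZero m] (g : ShiftRotationGroup m) (q : ZMod m × WithBot ℝ) :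
    (h.invariantsEquiv g).1 (h.circleEquiv q) = h.circleEquiv (coordAction g q) :=
  h.circleAction_apply g q

end IsArcSystem

/-! ### The presentation of the semidirect product. -/

namespace ShiftRotationGroup
variable {m : ℕ}

/-- The generators of the shift-rotation group. -/
noncomputable def gen (m : ℕ) : ZMod m ⊕ Unit → ShiftRotationGroup m
  | Sum.inl j => SemidirectProduct.inl (Pi.mulSingle j (Multiplicative.ofAdd (1 : ℤ)))
  | Sum.inr _ => SemidirectProduct.inr (Multiplicative.ofAdd (1 : ZMod m))

lemma mulAutArrow_mulSingle (r : Multiplicative (ZMod m)) (j : ZMod m) (v : Multiplicative ℤ) :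
    mulAutArrow (G := Multiplicative (ZMod m)) (A := ZMod m) (M := Multiplicative ℤ) r
      (Pi.mulSingle j v) = Pi.mulSingle (j + Multiplicative.toAdd r) v := by
  funext a
  change Pi.mulSingle (M := fun _ : ZMod m => Multiplicative ℤ) j v
    (-Multiplicative.toAdd r + a) = _
  simp only [Pi.mulSingle_apply]
  congr 1
  rw [neg_add_eq_iff_eq_add, add_comm]

lemma lift_gen_eq_one (r : FreeGroup (ZMod m ⊕ Unit)) (hr : r ∈ shiftRotationRels m) :
    FreeGroup.lift (gen m) r = 1 := by
  rcases hr with (hr | ⟨j, rfl⟩) | ⟨⟨j, l⟩, rfl⟩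
  · rw [mem_singleton_iff.1 hr, map_pow, FreeGroup.lift_apply_of, gen, ← map_pow, ← ofAdd_nsmul]
    simp
  · simp only [map_mul, map_inv, FreeGroup.lift_apply_of, gen, mul_inv_eq_one]
    have := SemidirectProduct.inl_aut (φ := mulAutArrow (G := Multiplicative (ZMod m)) (A := ZMod m)
      (M := Multiplicative ℤ)) (Multiplicative.ofAdd (1 : ZMod m))
      (Pi.mulSingle j (Multiplicative.ofAdd (1 : ℤ)))
    rw [mulAutArrow_mulSingle, toAdd_ofAdd, map_inv] at this
    rw [this]
    group
  · simp only [map_mul, map_inv, FreeGroup.lift_apply_of, gen, mul_inv_eq_one]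
    rw [← map_mul, ← map_mul, mul_comm]

/-- The canonical map from the presented group. -/
noncomputable def ofPresented (m : ℕ) :
    PresentedGroup (shiftRotationRels m) →* ShiftRotationGroup m :=
  PresentedGroup.toGroup lift_gen_eq_one

lemma presented_pow_eq_one (m : ℕ) :
    (PresentedGroup.of (Sum.inr ()) : PresentedGroup (shiftRotationRels m)) ^ m = 1 :=
  PresentedGroup.one_of_mem (rels := shiftRotationRels m) (Or.inl (Or.inl rfl))

lemma presented_rotate (j : ZMod m) :
    (PresentedGroup.of (Sum.inr ()) : PresentedGroup (shiftRotationRels m)) *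
      PresentedGroup.of (Sum.inl j)
      = PresentedGroup.of (Sum.inl (j + 1)) * PresentedGroup.of (Sum.inr ()) :=
  mul_inv_eq_one.1 (PresentedGroup.one_of_mem (rels := shiftRotationRels m)
    (Or.inl (Or.inr ⟨j, rfl⟩)))

lemma presented_commute (j l : ZMod m) :
    Commute (PresentedGroup.of (Sum.inl j) : PresentedGroup (shiftRotationRels m))
      (PresentedGroup.of (Sum.inl l)) :=
  mul_inv_eq_one.1 (PresentedGroup.one_of_mem (rels := shiftRotationRels m) (Or.inr ⟨(j, l), rfl⟩))

lemma presented_rotate_pow (j : ZMod m) (k : ℕ) :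
    (PresentedGroup.of (Sum.inr ()) : PresentedGroup (shiftRotationRels m)) ^ k *
      PresentedGroup.of (Sum.inl j)
      = PresentedGroup.of (Sum.inl (j + k)) * PresentedGroup.of (Sum.inr ()) ^ k := by
  induction k with
  | zero => simp
  | succ k ih =>
    rw [pow_succ', mul_assoc, ih, ← mul_assoc, presented_rotate, mul_assoc, Nat.cast_succ, add_assoc]

/-- The rotations in the presented group. -/
noncomputable def rotHom (m : ℕ) :
    Multiplicative (ZMod m) →* PresentedGroup (shiftRotationRels m) :=
  AddMonoidHom.toMultiplicativeLeft (ZMod.lift m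
    ⟨zmultiplesHom (Additive (PresentedGroup (shiftRotationRels m)))
      (Additive.ofMul (PresentedGroup.of (Sum.inr ()))), by
      rw [zmultiplesHom_apply, natCast_zsmul, ← ofMul_pow, presented_pow_eq_one, ofMul_one]⟩)

lemma rotHom_natCast (k : ℕ) : rotHom m (Multiplicative.ofAdd (k : ZMod m))
    = PresentedGroup.of (Sum.inr ()) ^ k := by
  have := ZMod.lift_coe m (A := Additive (PresentedGroup (shiftRotationRels m)))
    ⟨zmultiplesHom (Additive (PresentedGroup (shiftRotationRels m)))
      (Additive.ofMul (PresentedGroup.of (Sum.inr ()))), by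
      rw [zmultiplesHom_apply, natCast_zsmul, ← ofMul_pow, presented_pow_eq_one, ofMul_one]⟩ k
  rw [Int.cast_natCast] at this
  refine (congrArg Additive.toMul this).trans ?_
  simp

variable [NeZero m]

lemma presented_zpowers_commute (m : ℕ) : Pairwise fun j l : ZMod m => ∀ x y : Multiplicative ℤ,
    Commute (zpowersHom (PresentedGroup (shiftRotationRels m)) (PresentedGroup.of (Sum.inl j)) x)
      (zpowersHom (PresentedGroup (shiftRotationRels m)) (PresentedGroup.of (Sum.inl l)) y) := by
  intro j l _ x y
  simp only [zpowersHom_apply]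
  exact (presented_commute j l).zpow_zpow _ _

/-- The shifts in the presented group. -/
noncomputable def shiftHom (m : ℕ) [NeZero m] :
    (ZMod m → Multiplicative ℤ) →* PresentedGroup (shiftRotationRels m) :=
  MonoidHom.noncommPiCoprod
    (fun j : ZMod m => zpowersHom (PresentedGroup (shiftRotationRels m))
      (PresentedGroup.of (Sum.inl j)))
    (presented_zpowers_commute m)

lemma shiftHom_mulSingle (j : ZMod m) : shiftHom m (Pi.mulSingle j (Multiplicative.ofAdd (1 : ℤ)))
    = PresentedGroup.of (Sum.inl j) := by
  rw [shiftHom, MonoidHom.noncommPiCoprod_mulSingle]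
  simp

/-- Homomorphisms from `ℤ ^ m` that agree on the standard basis are equal. -/
lemma monoidHom_ext {H : Type*} [Group H] {f g : (ZMod m → Multiplicative ℤ) →* H}
    (h : ∀ j, f (Pi.mulSingle j (Multiplicative.ofAdd (1 : ℤ)))
      = g (Pi.mulSingle j (Multiplicative.ofAdd (1 : ℤ)))) : f = g := by
  refine MonoidHom.pi_ext fun j v => ?_
  have hj : f.comp (MonoidHom.mulSingle _ j) = g.comp (MonoidHom.mulSingle _ j) :=
    MonoidHom.ext_mint (h j)
  exact DFunLike.congr_fun hj v

/-- The canonical map to the presented group. -/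
noncomputable def toPresented (m : ℕ) [NeZero m] :
    ShiftRotationGroup m →* PresentedGroup (shiftRotationRels m) :=
  SemidirectProduct.lift (shiftHom m) (rotHom m) fun g => by
    refine monoidHom_ext fun j => ?_
    -- Every rotation is a natural power of the generator, so compatibility with the action follows
    -- by iterating y x_j = x_(j+1) y.
    obtain ⟨k, rfl⟩ : ∃ k : ℕ, g = Multiplicative.ofAdd (k : ZMod m) :=
      ⟨(Multiplicative.toAdd g).val, by rw [ZMod.natCast_zmod_val, ofAdd_toAdd]⟩
    simp only [MonoidHom.comp_apply, MulEquiv.coe_toMonoidHom, mulAutArrow_mulSingle,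
      shiftHom_mulSingle, toAdd_ofAdd, MulAut.conj_apply, rotHom_natCast]
    rw [presented_rotate_pow, mul_inv_cancel_right]

/-- The shift-rotation group has the standard presentation. -/
noncomputable def presentedEquiv (m : ℕ) [NeZero m] :
    PresentedGroup (shiftRotationRels m) ≃* ShiftRotationGroup m :=
  MonoidHom.toMulEquiv (ofPresented m) (toPresented m)
    (by
      refine PresentedGroup.ext fun q => ?_
      rcases q with j | u
      · simp [ofPresented, toPresented, gen, shiftHom_mulSingle]
      · have := rotHom_natCast (m := m) 1
        rw [Nat.cast_one, pow_one] at this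
        simp [ofPresented, toPresented, gen, this])
    (by
      refine SemidirectProduct.hom_ext (monoidHom_ext fun j => ?_)
        (MonoidHom.ext fun g => ?_)
      · simp [ofPresented, toPresented, gen, shiftHom_mulSingle]
      · obtain ⟨k, rfl⟩ : ∃ k : ℕ, g = Multiplicative.ofAdd (k : ZMod m) :=
          ⟨(Multiplicative.toAdd g).val, by rw [ZMod.natCast_zmod_val, ofAdd_toAdd]⟩
        simp only [MonoidHom.comp_apply, toPresented, SemidirectProduct.lift_inr, rotHom_natCast,
          map_pow, ofPresented, PresentedGroup.toGroup.of, gen, MonoidHom.id_apply]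
        rw [← map_pow, ← ofAdd_nsmul, nsmul_one])

lemma presentedEquiv_of (q : ZMod m ⊕ Unit) :
    presentedEquiv m (PresentedGroup.of q) = gen m q :=
  PresentedGroup.toGroup.of lift_gen_eq_one

end ShiftRotationGroup

/-! ### Labelling of the solutions and the final assembly. -/

/-- The argument of a point of the circle in `[0, 2 π)`. -/
noncomputable def Circle.argIco (w : Circle) : ℝ :=
  toIcoMod Real.two_pi_pos 0 (Complex.arg w)

lemma Circle.argIco_mem (w : Circle) : w.argIco ∈ Ico 0 (2 * Real.pi) := by
  have := toIcoMod_mem_Ico Real.two_pi_pos 0 (Complex.arg w)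
  rwa [zero_add] at this

lemma Circle.exp_argIco (w : Circle) : Circle.exp w.argIco = w := by
  conv_rhs => rw [← Circle.exp_arg w]
  rw [Circle.exp_eq_exp]
  refine ⟨-toIcoDiv Real.two_pi_pos 0 (Complex.arg w), ?_⟩
  rw [Circle.argIco, toIcoMod, zsmul_eq_mul]
  push_cast
  ring

lemma Circle.argIco_one : (1 : Circle).argIco = 0 := by
  simp [Circle.argIco]

namespace IsArcSystem
variable {B : ℂ → ℂ} {m : ℕ} {t : ℤ → ℝ} {ψ : ℤ → ℝ → ℝ} (h : IsArcSystem B m t ψ)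
include h

/-- On each arc the solutions of `B = w` have coordinates arg w + 2πn. Taking the argument in [0,
2π), with value 0 at 1, makes the normalisation of index 0 a consequence of monotonicity. -/
lemma isLabelling :
    IsLabelling B m t fun j n w => ψ j (w.argIco + 2 * Real.pi * n) where
  strictMono j w n n' hn := by
    refine h.strictMono j ?_
    have : (n : ℝ) < n' := by exact_mod_cast hn
    have := Real.two_pi_pos
    gcongr
  range_eq j w := by
    ext s
    constructor
    · rintro ⟨n, rfl⟩
      refine ⟨h.mem_Ioo _ _, ?_⟩
      rw [h.boundaryValue_exp, Circle.exp_add, Circle.exp_two_pi_mul_int, mul_one,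
        Circle.exp_argIco]
    · rintro ⟨hs, hsw⟩
      rw [← h.range_eq] at hs
      obtain ⟨u, rfl⟩ := hs
      rw [h.boundaryValue_exp, ← Circle.exp_argIco w] at hsw
      obtain ⟨n, rfl⟩ := Circle.exp_eq_exp.1 (Circle.coe_injective hsw)
      exact ⟨n, by simp only [mul_comm]⟩
  base j w := by
    have hw := w.argIco_mem
    simp only [Circle.argIco_one, Int.cast_zero, mul_zero, add_zero, Int.cast_one, mul_one,
      zero_add]
    exact ⟨(h.strictMono j).monotone hw.1, h.strictMono j hw.2⟩
  add_period j n w := h.add_period j _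

lemma circleEquiv_intCast_coe (j : ℤ) (u : ℝ) :
    h.circleEquiv ((j : ZMod m), (u : WithBot ℝ)) = Circle.exp (ψ j u) :=
  h.circleEquiv_intCast j u

variable [NeZero m]

lemma invariantsEquiv_shift_apply (j : ℤ) (u : ℝ) :
    (h.invariantsEquiv (ShiftRotationGroup.gen m (Sum.inl (j : ZMod m)))).1 (Circle.exp (ψ j u))
      = Circle.exp (ψ j (u + 2 * Real.pi)) := by
  rw [← h.circleEquiv_intCast_coe, h.invariantsEquiv_apply, ← h.circleEquiv_intCast_coe]
  simp [coordAction, ShiftRotationGroup.gen]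

lemma invariantsEquiv_shift_apply_of_ne {j k : ℤ} (hjk : (j : ZMod m) ≠ (k : ZMod m)) (u : ℝ) :
    (h.invariantsEquiv (ShiftRotationGroup.gen m (Sum.inl (j : ZMod m)))).1 (Circle.exp (ψ k u))
      = Circle.exp (ψ k u) := by
  rw [← h.circleEquiv_intCast_coe, h.invariantsEquiv_apply]
  simp [coordAction, ShiftRotationGroup.gen, Pi.mulSingle_eq_of_ne hjk.symm]

lemma invariantsEquiv_rotate_apply (j : ℤ) (u : ℝ) :
    (h.invariantsEquiv (ShiftRotationGroup.gen m (Sum.inr ()))).1 (Circle.exp (ψ j u))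
      = Circle.exp (ψ (j + 1) u) := by
  rw [← h.circleEquiv_intCast_coe, h.invariantsEquiv_apply, ← h.circleEquiv_intCast_coe]
  simp [coordAction, ShiftRotationGroup.gen]

end IsArcSystem

theorem mainTheorem6 (B : ℂ → ℂ) (hB : IsBlaschkeProduct B) (m : ℕ) (hm : 0 < m)
    (hcard : (singularities B).ncard = m)
    (hzeros : ∀ w ∈ singularities B, ∃ α : ℝ, 1 < α ∧
      (w : ℂ) ∈ closure (discZeros B ∩ stolzRegion α w)) :
    ∃ (t : ℤ → ℝ) (z : ℤ → ℤ → Circle → ℝ) (x : ZMod m → invariants B) (y : invariants B),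
      IsCyclicEnumeration (singularities B) m t ∧
      IsLabelling B m t z ∧
      -- `x_j` shifts the arc `I_j` and fixes all other arcs pointwise
      (∀ (j n : ℤ) (w : Circle),
        (x j).1 (Circle.exp (z j n w)) = Circle.exp (z j (n + 1) w)) ∧
      (∀ j k : ℤ, (j : ZMod m) ≠ (k : ZMod m) → ∀ s ∈ Set.Ioo (t k) (t (k + 1)),
        (x j).1 (Circle.exp s) = Circle.exp s) ∧
      -- `y` moves each arc to the next one
      (∀ (j n : ℤ) (w : Circle),
        y.1 (Circle.exp (z j n w)) = Circle.exp (z (j + 1) n w)) ∧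
      -- the presentation
      (∃ e : PresentedGroup (shiftRotationRels m) ≃* invariants B,
        (∀ j : ZMod m, e (PresentedGroup.of (Sum.inl j)) = x j) ∧
        e (PresentedGroup.of (Sum.inr ())) = y) ∧
      -- the semidirect product
      (∃ e : invariants B ≃* ShiftRotationGroup m,
        (∀ j : ZMod m, e (x j) =
          SemidirectProduct.inl (Pi.mulSingle j (Multiplicative.ofAdd (1 : ℤ)))) ∧
        e y = SemidirectProduct.inr (Multiplicative.ofAdd (1 : ZMod m))) := by
  have : NeZero m := ⟨hm.ne'⟩
  obtain ⟨t, ψ, h⟩ := hB.exists_isArcSystem hm hcard hzeros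
  refine ⟨t, fun j n w => ψ j (w.argIco + 2 * Real.pi * n),
    fun j => h.invariantsEquiv (ShiftRotationGroup.gen m (Sum.inl j)),
    h.invariantsEquiv (ShiftRotationGroup.gen m (Sum.inr ())), h.enum, h.isLabelling,
    fun j n w => ?_, fun j k hjk s hs => ?_, fun j n w => ?_,
    ⟨(ShiftRotationGroup.presentedEquiv m).trans h.invariantsEquiv, fun j => ?_, ?_⟩,
    ⟨h.invariantsEquiv.symm, fun j => ?_, ?_⟩⟩
  · refine (h.invariantsEquiv_shift_apply j _).trans ?_
    push_cast
    ring_nf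
  · rw [← h.range_eq] at hs
    obtain ⟨u, rfl⟩ := hs
    exact h.invariantsEquiv_shift_apply_of_ne hjk u
  · exact h.invariantsEquiv_rotate_apply j _
  · rw [MulEquiv.trans_apply, ShiftRotationGroup.presentedEquiv_of]
  · rw [MulEquiv.trans_apply, ShiftRotationGroup.presentedEquiv_of]
  · rw [MulEquiv.symm_apply_apply]
    rfl
  · rw [MulEquiv.symm_apply_apply]
    rfl
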